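/- Let $p>0$ be a real number and let $$E=E(1,1,p)=\{(z,w)\in\mathbb{C}\times\mathbb{C} : |z|^2+|w|^{2p}<1\}.$$ Let $A^2(E)$ be the space of holomorphic functions on $E$ that are square integrable with respect to Lebesgue measure, let $(\varphi_j)_{j\in\mathbb{N}}$ be an orthonormal basis of $A^2(E)$, and let $K_E=\sum_j\varphi_j\overline{\varphi_j}$ be the Bergman kernel of $E$ on the diagonal. Write $\partial_1=\partial/\partial z$, $\partial_2=\partial/\partial w$, $\partial_{\bar 1}=\partial/\partial\bar z$, $\partial_{\bar 2}=\partial/\partial\bar w$. The Bergman metric of $E$ has the components $g_{i\bar j}=\partial_i\partial_{\bar j}\log K_E$, and its Ricci tensor has the components $\mathrm{Ric}_{i\bar j}=-\partial_i\partial_{\bar j}\log\det(g_{k\bar l})$, $i,j\in\{1,2\}$. Then $K_E$ is positive and $C^\infty$ on $E$, and at every point $(z,w)\in E$ with $z=\bar z$ and $w=0$ the matrix $(g_{i\bar j})$ is positive definite and $$\mathrm{Ric}_{1\bar 1}=-\frac{2p+1}{p\,(1-|z|^2)^2},\qquad \mathrm{Ric}_{1\bar 2}=\mathrm{Ric}_{2\bar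 1}=0,$$ $$\mathrm{Ric}_{2\bar 2}=-\frac{2\,(2p^3+10p^2+10p+5)}{(p+1)(p+2)(2p+1)\,(1-|z|^2)^{1/p}}.$$ -/

import Mathlib

open MeasureTheory
open scoped ContDiff ComplexOrder

noncomputable section

/-- The complex ellipsoid `E(1,1,p) = {(z,w) ∈ ℂ × ℂ : |z|² + |w|^(2p) < 1}`; the coordinates of
`q : Fin 2 → ℂ` are `z = q 0` and `w = q 1`. -/
def ellipsoid (p : ℝ) : Set (Fin 2 → ℂ) :=
  {q | ‖q 0‖ ^ 2 + ‖q 1‖ ^ (2 * p) < 1}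

/-- `φ` is an orthonormal basis (indexed by `ℕ`) of `A²(G)`, the space of holomorphic functions on
`G ⊆ ℂⁿ` that are square integrable on `G` for Lebesgue measure: every `φ j` lies in `A²(G)`, the
family is orthonormal in `L²(G)`, and its linear span is dense in `A²(G)`. -/
structure IsBergmanBasis {n : ℕ} (G : Set (Fin n → ℂ)) (φ : ℕ → (Fin n → ℂ) → ℂ) : Prop where
  holomorphic : ∀ j, DifferentiableOn ℂ (φ j) G
  memLp : ∀ j, MemLp (φ j) 2 (volume.restrict G)
  orthonormal : Orthonormal ℂ fun j => (memLp j).toLp (φ j)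
  dense : ∀ (f : (Fin n → ℂ) → ℂ) (_ : DifferentiableOn ℂ f G)
    (hf : MemLp f 2 (volume.restrict G)),
    hf.toLp f ∈ (Submodule.span ℂ
      (Set.range fun j => (memLp j).toLp (φ j))).topologicalClosure

open Classical in
/-- The Bergman kernel on the diagonal, `K_G(z, z̄) = ∑ⱼ φⱼ(z) conj (φⱼ(z)) = ∑ⱼ |φⱼ(z)|²`, for an
orthonormal basis `(φⱼ)` of `A²(G)`. The value does not depend on the basis. (On a nonempty bounded
domain of `ℂⁿ`, `n ≥ 1`, a basis indexed by `ℕ` exists; without one the value is set to `0`.) -/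
def bergmanKernel {n : ℕ} (G : Set (Fin n → ℂ)) (q : Fin n → ℂ) : ℝ :=
  if h : ∃ φ : ℕ → (Fin n → ℂ) → ℂ, IsBergmanBasis G φ then ∑' j, ‖h.choose j q‖ ^ 2 else 0

/-- `∂f/∂zⱼ = (∂f/∂xⱼ - i ∂f/∂yⱼ) / 2`, where `zⱼ = xⱼ + i yⱼ`. -/
def dz {n : ℕ} (j : Fin n) (f : (Fin n → ℂ) → ℂ) (q : Fin n → ℂ) : ℂ :=
  (lineDeriv ℝ f q (Pi.single j 1) - Complex.I * lineDeriv ℝ f q (Pi.single j Complex.I)) / 2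

/-- `∂f/∂z̄ⱼ = (∂f/∂xⱼ + i ∂f/∂yⱼ) / 2`, where `zⱼ = xⱼ + i yⱼ`. -/
def dzbar {n : ℕ} (j : Fin n) (f : (Fin n → ℂ) → ℂ) (q : Fin n → ℂ) : ℂ :=
  (lineDeriv ℝ f q (Pi.single j 1) + Complex.I * lineDeriv ℝ f q (Pi.single j Complex.I)) / 2

/-- The components `g_{i j̄} = ∂² log K_G / ∂zᵢ ∂z̄ⱼ` of the Bergman metric of `G`. -/
def bergmanMetric {n : ℕ} (G : Set (Fin n → ℂ)) (q : Fin n → ℂ) : Matrix (Fin n) (Fin n) ℂ :=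
  Matrix.of fun i j => dz i (dzbar j fun x => ((Real.log (bergmanKernel G x) : ℝ) : ℂ)) q

/-- The components `Ric_{i j̄} = -∂² log det g / ∂zᵢ ∂z̄ⱼ` of the Ricci tensor of a Kähler metric
with components `g_{i j̄}` (a positive definite Hermitian matrix, so that `det g` is a positive real
number, here read off by its real part). -/
def kaehlerRicci {n : ℕ} (g : (Fin n → ℂ) → Matrix (Fin n) (Fin n) ℂ) (q : Fin n → ℂ) :
    Matrix (Fin n) (Fin n) ℂ :=
  Matrix.of fun i j => -dz i (dzbar j fun x => ((Real.log (g x).det.re : ℝ) : ℂ)) q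

end

/-! Write `t = 1 - |z|²` and `u = |w|² t^(-1/p)`, so that `E` is the set where `t > 0` and `u < 1`.
Since `E` is invariant under rotations of each coordinate, the monomials `z^a w^b` are orthogonal,
and they span a dense subspace because every holomorphic function on `E` has a power series
expansion (`isBergmanBasis_ellipsoidBasis`). Their norms are beta integrals (`monomialNormSq_eq`).
Summing a binomial series over `a` and then a geometric-type series over `b` gives `K = t^(-(2+1/p))
((p+1) + (1-p)u) / (p π² (1-u)³)`. The sum does not depend on the basis
(`IsBergmanBasis.hasSum_norm_sq`), so this is the kernel of the statement
(`bergmanKernel_ellipsoid`).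

Hence `log K = -c log t + k(u)` with `c = 2 + 1/p`. Functions of this shape have an explicit complex
Hessian (`complexHessian_radialPotential`). Applied to `log K`, it yields `det g = A(u) B(u) t^(-c)`
(`det_bergmanMetric_ellipsoid`). Thus `log det g` has the same shape with the same `c`, and a second
application gives the Ricci tensor. At `w = 0` one has `u = 0`, and the tensor is minus the diagonal
matrix with entries `c / t²` and `t^(-1/p) (log AB)'(0)`. -/

open scoped InnerProductSpace

/-! ### Wirtinger calculus. -/

/-- `f` is real differentiable at `q` with Wirtinger derivatives `∂f/∂zⱼ = a j` and
`∂f/∂z̄ⱼ = b j`. -/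
def HasWirtingerAt {n : ℕ} (f : (Fin n → ℂ) → ℂ) (a b : Fin n → ℂ) (q : Fin n → ℂ) : Prop :=
  ∃ L : (Fin n → ℂ) →L[ℝ] ℂ, HasFDerivAt f L q ∧
    ∀ v, L v = ∑ j, (a j * v j + b j * (starRingEnd ℂ) (v j))

namespace HasWirtingerAt

variable {n : ℕ} {f g : (Fin n → ℂ) → ℂ} {a b a' b' : Fin n → ℂ} {q : Fin n → ℂ}

theorem lineDeriv_single (h : HasWirtingerAt f a b q) (j : Fin n) (x : ℂ) :
    lineDeriv ℝ f q (Pi.single j x) = a j * x + b j * (starRingEnd ℂ) x := by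
  obtain ⟨L, hL, hv⟩ := h
  rw [(hL.hasLineDerivAt _).lineDeriv, hv, Finset.sum_eq_single j]
  · simp
  · intro i _ hi
    simp [hi]
  · simp

theorem dz_eq (h : HasWirtingerAt f a b q) (j : Fin n) : dz j f q = a j := by
  rw [dz, h.lineDeriv_single, h.lineDeriv_single]
  simp only [map_one, Complex.conj_I]
  linear_combination (b j - a j) / 2 * Complex.I_mul_I

theorem dzbar_eq (h : HasWirtingerAt f a b q) (j : Fin n) : dzbar j f q = b j := by
  rw [dzbar, h.lineDeriv_single, h.lineDeriv_single]
  simp only [map_one, Complex.conj_I]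
  linear_combination (a j - b j) / 2 * Complex.I_mul_I

theorem const (c : ℂ) : HasWirtingerAt (fun _ => c) (fun _ : Fin n => 0) (fun _ => 0) q :=
  ⟨0, hasFDerivAt_const c q, by simp⟩

theorem coord (j : Fin n) :
    HasWirtingerAt (fun q => q j) (Pi.single j 1) (fun _ => 0) q := by
  refine ⟨ContinuousLinearMap.proj j, hasFDerivAt_apply j q, fun v => ?_⟩
  simp [Pi.single_apply]

theorem conj (h : HasWirtingerAt f a b q) :
    HasWirtingerAt (fun x => (starRingEnd ℂ) (f x)) (fun j => (starRingEnd ℂ) (b j))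
      (fun j => (starRingEnd ℂ) (a j)) q := by
  obtain ⟨L, hL, hv⟩ := h
  refine ⟨(Complex.conjCLE : ℂ →L[ℝ] ℂ).comp L,
    ((Complex.conjCLE : ℂ →L[ℝ] ℂ).hasFDerivAt).comp q hL, fun v => ?_⟩
  simp only [ContinuousLinearMap.comp_apply, hv, map_sum, map_add, map_mul,
    ContinuousLinearEquiv.coe_coe, Complex.conjCLE_apply, Complex.conj_conj]
  exact Finset.sum_congr rfl fun j _ => add_comm _ _

theorem add (hf : HasWirtingerAt f a b q) (hg : HasWirtingerAt g a' b' q) :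
    HasWirtingerAt (fun x => f x + g x) (fun j => a j + a' j) (fun j => b j + b' j) q := by
  obtain ⟨L, hL, hv⟩ := hf
  obtain ⟨M, hM, hw⟩ := hg
  refine ⟨L + M, hL.add hM, fun v => ?_⟩
  rw [show (L + M) v = L v + M v from rfl, hv, hw, ← Finset.sum_add_distrib]
  exact Finset.sum_congr rfl fun j _ => by ring

theorem mul (hf : HasWirtingerAt f a b q) (hg : HasWirtingerAt g a' b' q) :
    HasWirtingerAt (fun x => f x * g x) (fun j => f q * a' j + g q * a j)
      (fun j => f q * b' j + g q * b j) q := by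
  obtain ⟨L, hL, hv⟩ := hf
  obtain ⟨M, hM, hw⟩ := hg
  refine ⟨f q • M + g q • L, hL.mul hM, fun v => ?_⟩
  rw [show (f q • M + g q • L) v = f q * M v + g q * L v from rfl, hv, hw,
    Finset.mul_sum, Finset.mul_sum, ← Finset.sum_add_distrib]
  exact Finset.sum_congr rfl fun j _ => by ring

/-- Chain rule for a real function of a real-valued function. -/
theorem ofReal_comp {r : (Fin n → ℂ) → ℝ} {φ : ℝ → ℝ} {φ' : ℝ}
    (hr : HasWirtingerAt (fun x => (r x : ℂ)) a b q) (hφ : HasDerivAt φ φ' (r q)) :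
    HasWirtingerAt (fun x => (φ (r x) : ℂ)) (fun j => φ' * a j) (fun j => φ' * b j) q := by
  obtain ⟨L, hL, hv⟩ := hr
  have h1 : HasFDerivAt r (Complex.reCLM.comp L) q := by
    simpa [Function.comp_def] using (Complex.reCLM.hasFDerivAt).comp q hL
  have h2 : HasFDerivAt (fun x => (r x : ℂ)) (Complex.ofRealCLM.comp (Complex.reCLM.comp L)) q := by
    simpa [Function.comp_def] using (Complex.ofRealCLM.hasFDerivAt).comp q h1
  -- The function is real-valued, so by uniqueness of the derivative `L` takes real values, which is
  -- what lets `φ'` multiply both Wirtinger parts.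
  have h3 := hL.unique h2
  refine ⟨Complex.ofRealCLM.comp (φ' • Complex.reCLM.comp L), ?_, fun v => ?_⟩
  · simpa [Function.comp_def] using
      (Complex.ofRealCLM.hasFDerivAt).comp q (hφ.comp_hasFDerivAt q h1)
  · have h4 : ((L v).re : ℂ) = L v := by
      conv_rhs => rw [h3]
      simp
    have : Complex.ofRealCLM.comp (φ' • Complex.reCLM.comp L) v = φ' * ((L v).re : ℂ) := by simp
    rw [this, h4, hv, Finset.mul_sum]
    exact Finset.sum_congr rfl fun j _ => by ring

theorem congr_deriv (h : HasWirtingerAt f a b q) (ha : a = a') (hb : b = b') :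
    HasWirtingerAt f a' b' q := ha ▸ hb ▸ h

end HasWirtingerAt

theorem Filter.EventuallyEq.dz_eq {n : ℕ} {f g : (Fin n → ℂ) → ℂ} {q : Fin n → ℂ}
    (h : f =ᶠ[nhds q] g) (j : Fin n) : dz j f q = dz j g q := by
  simp only [dz, h.lineDeriv_eq]

theorem Filter.EventuallyEq.dzbar_eq {n : ℕ} {f g : (Fin n → ℂ) → ℂ} {q : Fin n → ℂ}
    (h : f =ᶠ[nhds q] g) (j : Fin n) : dzbar j f q = dzbar j g q := by
  simp only [dzbar, h.lineDeriv_eq]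

/-- Closed formulas for the kernel and the metric hold only on the ellipsoid; second derivatives at
a point need no more than the germ. -/
theorem Filter.EventuallyEq.dz_dzbar_eq {n : ℕ} {f g : (Fin n → ℂ) → ℂ} {q : Fin n → ℂ}
    (h : f =ᶠ[nhds q] g) (i j : Fin n) : dz i (dzbar j f) q = dz i (dzbar j g) q :=
  Filter.EventuallyEq.dz_eq (h.eventually_nhds.mono fun _ hx => Filter.EventuallyEq.dzbar_eq hx j) i

/-! ### Complex Hessians of functions `-c log t + k(u)`. -/

/-- The function `1 - |z|²` on `ℂ²`. -/
noncomputable def ballDefect (q : Fin 2 → ℂ) : ℝ := 1 - ‖q 0‖ ^ 2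

/-- The function `|w|² (1 - |z|²)^(-1/p)` on `ℂ²`, which is `< 1` exactly on the ellipsoid. -/
noncomputable def ellipsoidRadial (p : ℝ) (q : Fin 2 → ℂ) : ℝ :=
  ‖q 1‖ ^ 2 * ballDefect q ^ (-(1 / p))

theorem hasWirtingerAt_normSq {n : ℕ} (j : Fin n) (q : Fin n → ℂ) :
    HasWirtingerAt (fun x => ((‖x j‖ ^ 2 : ℝ) : ℂ))
      (Pi.single j ((starRingEnd ℂ) (q j))) (Pi.single j (q j)) q := by
  have h := (HasWirtingerAt.coord (q := q) j).mul (HasWirtingerAt.coord (q := q) j).conj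
  have e : (fun x : Fin n → ℂ => ((‖x j‖ ^ 2 : ℝ) : ℂ)) = fun x => x j * (starRingEnd ℂ) (x j) := by
    funext x
    rw [Complex.mul_conj, Complex.normSq_eq_norm_sq]
  rw [e]
  refine h.congr_deriv ?_ ?_
  · funext i
    by_cases hi : i = j
    · subst hi; simp
    · simp [hi]
  · funext i
    by_cases hi : i = j
    · subst hi; simp
    · simp [hi]

theorem hasWirtingerAt_ballDefect (q : Fin 2 → ℂ) :
    HasWirtingerAt (fun x => (ballDefect x : ℂ)) ![-(starRingEnd ℂ) (q 0), 0] ![-q 0, 0] q := by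
  have h := (hasWirtingerAt_normSq 0 q).ofReal_comp (φ := fun x => 1 - x)
    (by simpa using (hasDerivAt_id (‖q 0‖ ^ 2)).const_sub 1)
  refine h.congr_deriv ?_ ?_ <;> funext i <;> fin_cases i <;> simp

theorem continuous_ballDefect : Continuous ballDefect := by
  unfold ballDefect; fun_prop

/-- The derivative is written with `t^s / t` instead of `t^(s-1)`, so that a single power of `t`
occurs and `ring` can treat it as an atom. -/
theorem hasWirtingerAt_ballDefect_rpow (s : ℝ) {q : Fin 2 → ℂ} (hq : 0 < ballDefect q) :
    HasWirtingerAt (fun x => ((ballDefect x ^ s : ℝ) : ℂ))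
      ![-s * (ballDefect q ^ s : ℝ) / ballDefect q * (starRingEnd ℂ) (q 0), 0]
      ![-s * (ballDefect q ^ s : ℝ) / ballDefect q * q 0, 0] q := by
  have h := (hasWirtingerAt_ballDefect q).ofReal_comp
    (Real.hasDerivAt_rpow_const (p := s) (Or.inl hq.ne'))
  have hne : (ballDefect q : ℂ) ≠ 0 := by exact_mod_cast hq.ne'
  rw [Real.rpow_sub_one hq.ne'] at h
  refine h.congr_deriv ?_ ?_ <;> funext i <;> fin_cases i <;> simp <;> ring

theorem hasWirtingerAt_ellipsoidRadial (p : ℝ) {q : Fin 2 → ℂ} (hq : 0 < ballDefect q) :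
    HasWirtingerAt (fun x => (ellipsoidRadial p x : ℂ))
      ![ellipsoidRadial p q / (p * ballDefect q) * (starRingEnd ℂ) (q 0),
        (ballDefect q ^ (-(1 / p)) : ℝ) * (starRingEnd ℂ) (q 1)]
      ![ellipsoidRadial p q / (p * ballDefect q) * q 0,
        (ballDefect q ^ (-(1 / p)) : ℝ) * q 1] q := by
  have h := (hasWirtingerAt_normSq 1 q).mul (hasWirtingerAt_ballDefect_rpow (-(1 / p)) hq)
  have e : (fun x => (ellipsoidRadial p x : ℂ)) =
      fun x => ((‖x 1‖ ^ 2 : ℝ) : ℂ) * ((ballDefect x ^ (-(1 / p)) : ℝ) : ℂ) := by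
    funext x; rw [ellipsoidRadial]; push_cast; rfl
  rw [e]
  refine h.congr_deriv ?_ ?_ <;> funext i <;> fin_cases i <;>
    simp [ellipsoidRadial] <;> ring

/-- The potential `-c log (1 - |z|²) + k(u)`. -/
noncomputable def radialPotential (p c : ℝ) (k : ℝ → ℝ) (q : Fin 2 → ℂ) : ℝ :=
  -c * Real.log (ballDefect q) + k (ellipsoidRadial p q)

theorem hasWirtingerAt_radialPotential (p c : ℝ) {k : ℝ → ℝ} {k' : ℝ} {q : Fin 2 → ℂ}
    (hq : 0 < ballDefect q) (hk : HasDerivAt k k' (ellipsoidRadial p q)) :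
    HasWirtingerAt (fun x => (radialPotential p c k x : ℂ))
      ![(c + ellipsoidRadial p q * k' / p) / ballDefect q * (starRingEnd ℂ) (q 0),
        k' * ((ballDefect q ^ (-(1 / p)) : ℝ) * (starRingEnd ℂ) (q 1))]
      ![(c + ellipsoidRadial p q * k' / p) / ballDefect q * q 0,
        k' * ((ballDefect q ^ (-(1 / p)) : ℝ) * q 1)] q := by
  have h := ((hasWirtingerAt_ballDefect q).ofReal_comp
    ((Real.hasDerivAt_log hq.ne').const_mul (-c))).add
    ((hasWirtingerAt_ellipsoidRadial p hq).ofReal_comp hk)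
  have e : (fun x => (radialPotential p c k x : ℂ)) =
      fun x => ((-c * Real.log (ballDefect x) : ℝ) : ℂ) + (k (ellipsoidRadial p x) : ℂ) := by
    funext x; rw [radialPotential]; push_cast; rfl
  rw [e]
  refine h.congr_deriv ?_ ?_ <;> funext i <;> fin_cases i <;> simp <;> ring

theorem eventually_ballDefect_pos {q : Fin 2 → ℂ} (hq : 0 < ballDefect q) :
    ∀ᶠ x in nhds q, 0 < ballDefect x :=
  continuous_ballDefect.continuousAt.eventually (lt_mem_nhds hq)

theorem continuousAt_ellipsoidRadial (p : ℝ) {q : Fin 2 → ℂ} (hq : 0 < ballDefect q) :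
    ContinuousAt (ellipsoidRadial p) q := by
  unfold ellipsoidRadial
  exact ContinuousAt.mul ((continuous_apply 1).norm.pow 2).continuousAt
    (continuous_ballDefect.continuousAt.rpow_const (Or.inl hq.ne'))

/-- The complex Hessian of `-c log (1 - |z|²) + k(u)`. -/
theorem complexHessian_radialPotential (p c : ℝ) {k k' : ℝ → ℝ} {k'' : ℝ} {q : Fin 2 → ℂ}
    (hq : 0 < ballDefect q) (hk : ∀ᶠ u in nhds (ellipsoidRadial p q), HasDerivAt k (k' u) u)
    (hk' : HasDerivAt k' k'' (ellipsoidRadial p q)) (i j : Fin 2) :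
    dz i (dzbar j fun x => (radialPotential p c k x : ℂ)) q =
      !![((c + ellipsoidRadial p q * k' (ellipsoidRadial p q) / p +
          ‖q 0‖ ^ 2 * ellipsoidRadial p q *
            (k' (ellipsoidRadial p q) + ellipsoidRadial p q * k'') / p ^ 2) / ballDefect q ^ 2 : ℂ),
        (ballDefect q ^ (-(1 / p)) : ℝ) * q 1 * (starRingEnd ℂ) (q 0) / (p * ballDefect q) *
          (k' (ellipsoidRadial p q) + ellipsoidRadial p q * k'');
        (ballDefect q ^ (-(1 / p)) : ℝ) * (starRingEnd ℂ) (q 1) * q 0 / (p * ballDefect q) *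
          (k' (ellipsoidRadial p q) + ellipsoidRadial p q * k''),
        (ballDefect q ^ (-(1 / p)) : ℝ) *
          (k' (ellipsoidRadial p q) + ellipsoidRadial p q * k'')] i j := by
  have hne : (ballDefect q : ℂ) ≠ 0 := by exact_mod_cast hq.ne'
  have hu := hasWirtingerAt_ellipsoidRadial p hq
  have hku := hu.ofReal_comp hk'
  have hlocal : ∀ᶠ x in nhds q, 0 < ballDefect x ∧
      HasDerivAt k (k' (ellipsoidRadial p x)) (ellipsoidRadial p x) :=
    (eventually_ballDefect_pos hq).and ((continuousAt_ellipsoidRadial p hq).eventually hk)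
  -- Division by `p` and by `t` is expressed through a constant factor and a real power, so that the
  -- product rules above apply directly.
  have hbar0 : (dzbar 0 fun x => (radialPotential p c k x : ℂ)) =ᶠ[nhds q] fun x =>
      ((c : ℂ) + (ellipsoidRadial p x : ℂ) * (k' (ellipsoidRadial p x) : ℂ) * ((1 / p : ℝ) : ℂ)) *
        ((ballDefect x ^ (-1 : ℝ) : ℝ) : ℂ) * x 0 := by
    filter_upwards [hlocal] with x hx
    rw [(hasWirtingerAt_radialPotential p c hx.1 hx.2).dzbar_eq 0, Real.rpow_neg_one]
    simp [div_eq_mul_inv]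
  have hbar1 : (dzbar 1 fun x => (radialPotential p c k x : ℂ)) =ᶠ[nhds q] fun x =>
      (k' (ellipsoidRadial p x) : ℂ) * (((ballDefect x ^ (-(1 / p)) : ℝ) : ℂ) * x 1) := by
    filter_upwards [hlocal] with x hx
    rw [(hasWirtingerAt_radialPotential p c hx.1 hx.2).dzbar_eq 1]
    simp
  have h0 := (((HasWirtingerAt.const (c : ℂ)).add
    ((hu.mul hku).mul (HasWirtingerAt.const ((1 / p : ℝ) : ℂ)))).mul
      (hasWirtingerAt_ballDefect_rpow (-1) hq)).mul (HasWirtingerAt.coord 0)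
  have h1 := hku.mul ((hasWirtingerAt_ballDefect_rpow (-(1 / p)) hq).mul (HasWirtingerAt.coord 1))
  have hx : q 0 * (starRingEnd ℂ) (q 0) = (‖q 0‖ ^ 2 : ℂ) := by
    rw [Complex.mul_conj, Complex.normSq_eq_norm_sq]; push_cast; rfl
  -- Used in the `(0,0)` entry, where `1/t + |z|²/t² = 1/t²`.
  have hx' : (ballDefect q : ℂ) = 1 - q 0 * (starRingEnd ℂ) (q 0) := by
    rw [hx, ballDefect]; push_cast; rfl
  have hy : (ellipsoidRadial p q : ℂ) =
      q 1 * (starRingEnd ℂ) (q 1) * ((ballDefect q ^ (-(1 / p)) : ℝ) : ℂ) := by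
    rw [Complex.mul_conj, Complex.normSq_eq_norm_sq, ellipsoidRadial]; push_cast; rfl
  fin_cases j
  · change dz i (dzbar 0 _) q = _
    rw [hbar0.dz_eq, h0.dz_eq]
    fin_cases i
    · simp [Real.rpow_neg_one, ← hx]
      field_simp
      rw [hx']
      ring
    · simp [Real.rpow_neg_one]
      field_simp
      ring
  · change dz i (dzbar 1 _) q = _
    rw [hbar1.dz_eq, h1.dz_eq]
    fin_cases i
    · simp
      ring
    · simp
      rw [hy]
      ring_nf

/-! ### Orthonormal bases of Bergman spaces. -/

/-- Parseval's identity for a vector in the closed span of an orthonormal family. -/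
theorem Orthonormal.hasSum_norm_inner_sq {H ι : Type*} [NormedAddCommGroup H]
    [InnerProductSpace ℂ H] [CompleteSpace H] {v : ι → H} (hv : Orthonormal ℂ v) {x : H}
    (hx : x ∈ (Submodule.span ℂ (Set.range v)).topologicalClosure) :
    HasSum (fun i => ‖⟪v i, x⟫_ℂ‖ ^ 2) (‖x‖ ^ 2) := by
  classical
  have hspan : (⨆ i, LinearMap.range (LinearIsometry.toSpanSingleton ℂ H (hv.1 i)).toLinearMap) =
      Submodule.span ℂ (Set.range v) := by
    simp [← LinearMap.span_singleton_eq_range, ← Submodule.span_iUnion]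
  rw [← hspan, ← hv.orthogonalFamily.range_linearIsometry] at hx
  obtain ⟨f, rfl⟩ := hx
  have hs := hv.orthogonalFamily.hasSum_linearIsometry f
  set y := hv.orthogonalFamily.linearIsometry f with hy
  have hcoef : ∀ j, ⟪v j, y⟫_ℂ = f j := fun j => by
    have h1 := hs.mapL (innerSL ℂ (v j))
    have h2 := hasSum_single (f := fun i => innerSL ℂ (v j)
      ((LinearIsometry.toSpanSingleton ℂ H (hv.1 i)) (f i))) j (fun i hi => by
        simp [hv.2 hi.symm])
    rw [← innerSL_apply_apply ℂ, h1.unique h2]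
    simp [inner_self_eq_norm_sq_to_K, hv.1 j]
  have h3 := (hs.mapL (innerSL ℂ y)).mapL Complex.reCLM
  have h4 : Complex.reCLM (innerSL ℂ y y) = ‖y‖ ^ 2 := by
    rw [innerSL_apply_apply, inner_self_eq_norm_sq_to_K]
    norm_cast
  change HasSum (fun i => ‖⟪v i, y⟫_ℂ‖ ^ 2) (‖y‖ ^ 2)
  rw [← h4]
  refine h3.congr_fun fun i => ?_
  rw [hcoef i]
  have h5 : ⟪y, v i⟫_ℂ = (starRingEnd ℂ) (f i) := by rw [← hcoef i, inner_conj_symm]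
  simp only [LinearIsometry.toSpanSingleton_apply, map_smul, innerSL_apply_apply, h5, smul_eq_mul,
    Complex.mul_conj, Complex.reCLM_apply, Complex.normSq_eq_norm_sq, Complex.ofReal_re]

theorem Orthonormal.summable_smul {H ι : Type*} [NormedAddCommGroup H]
    [InnerProductSpace ℂ H] [CompleteSpace H] {v : ι → H} (hv : Orthonormal ℂ v) {c : ι → ℂ}
    (hc : Summable fun i => ‖c i‖ ^ 2) : Summable fun i => c i • v i :=
  (hv.orthogonalFamily.summable_iff_norm_sq_summable c).2 hc

/-- If evaluation at `q` is represented by the orthonormal basis `e`, then `∑ⱼ |ψⱼ(q)|²` is the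
same for every other orthonormal basis `ψ` of the Bergman space. -/
theorem IsBergmanBasis.hasSum_norm_sq {n : ℕ} {G : Set (Fin n → ℂ)} {e ψ : ℕ → (Fin n → ℂ) → ℂ}
    (he : IsBergmanBasis G e) (hψ : IsBergmanBasis G ψ) {q : Fin n → ℂ} {S : ℝ}
    (hS : HasSum (fun j => ‖e j q‖ ^ 2) S)
    (hrep : ∀ (f : (Fin n → ℂ) → ℂ) (_ : DifferentiableOn ℂ f G)
      (hf : MemLp f 2 (volume.restrict G)),
      HasSum (fun j => e j q * ⟪(he.memLp j).toLp (e j), hf.toLp f⟫_ℂ) (f q)) :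
    HasSum (fun j => ‖ψ j q‖ ^ 2) S := by
  set E : ℕ → Lp ℂ 2 (volume.restrict G) := fun j => (he.memLp j).toLp (e j) with hE
  set Ψ : ℕ → Lp ℂ 2 (volume.restrict G) := fun j => (hψ.memLp j).toLp (ψ j) with hΨ
  -- The vector `K = ∑ conj(e_j(q)) e_j` represents evaluation at `q`. Parseval for `K` in either
  -- basis then computes the same number `‖K‖²`.
  have hsum : Summable fun j => (starRingEnd ℂ) (e j q) • E j :=
    he.orthonormal.summable_smul (by simpa using hS.summable)
  obtain ⟨K, hK⟩ := hsum
  have heval : ∀ (f : (Fin n → ℂ) → ℂ) (_ : DifferentiableOn ℂ f G)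
      (hf : MemLp f 2 (volume.restrict G)), ⟪hf.toLp f, K⟫_ℂ = (starRingEnd ℂ) (f q) := by
    intro f hd hf
    refine (hK.mapL (innerSL ℂ (hf.toLp f))).unique ?_
    have := (hrep f hd hf).map (starRingEnd ℂ) Complex.continuous_conj
    refine this.congr_fun fun j => ?_
    simp [hE]
  have hEΨ : ∀ j, E j ∈ (Submodule.span ℂ (Set.range Ψ)).topologicalClosure := fun j =>
    hψ.dense (e j) (he.holomorphic j) (he.memLp j)
  have hmemΨ : K ∈ (Submodule.span ℂ (Set.range Ψ)).topologicalClosure := by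
    refine (Submodule.isClosed_topologicalClosure _).mem_of_tendsto hK
      (Filter.Eventually.of_forall fun s => ?_)
    exact Submodule.sum_mem _ fun j _ => Submodule.smul_mem _ _ (hEΨ j)
  have hmemE : K ∈ (Submodule.span ℂ (Set.range E)).topologicalClosure := by
    refine (Submodule.isClosed_topologicalClosure _).mem_of_tendsto hK
      (Filter.Eventually.of_forall fun s => ?_)
    exact Submodule.sum_mem _ fun j _ => Submodule.smul_mem _ _
      (Submodule.le_topologicalClosure _ (Submodule.subset_span ⟨j, rfl⟩))
  have h1 := he.orthonormal.hasSum_norm_inner_sq hmemE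
  have h2 := hψ.orthonormal.hasSum_norm_inner_sq hmemΨ
  simp only [heval _ (he.holomorphic _), RCLike.norm_conj] at h1
  simp only [heval _ (hψ.holomorphic _), RCLike.norm_conj] at h2
  rwa [h1.unique hS] at h2

theorem coeFn_sum_smul_toLp {α ι : Type*} [MeasurableSpace α] {μ : Measure α} {e : ι → α → ℂ}
    (he : ∀ j, MemLp (e j) 2 μ) (c : ι → ℂ) (s : Finset ι) :
    (∑ j ∈ s, c j • (he j).toLp (e j) : Lp ℂ 2 μ) =ᵐ[μ] fun q => ∑ j ∈ s, e j q * c j := by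
  classical
  induction s using Finset.induction_on with
  | empty =>
    simp only [Finset.sum_empty]
    exact Lp.coeFn_zero ℂ 2 μ
  | insert a s ha ih =>
    rw [Finset.sum_insert ha]
    filter_upwards [Lp.coeFn_add (c a • (he a).toLp (e a)) (∑ j ∈ s, c j • (he j).toLp (e j)), ih,
      Lp.coeFn_smul (c a) ((he a).toLp (e a)), (he a).coeFn_toLp] with x h1 h2 h3 h4
    rw [h1, Pi.add_apply, h2, h3, Pi.smul_apply, h4, Finset.sum_insert ha, smul_eq_mul, mul_comm]

/-- An orthonormal family expanding every function of the Bergman space pointwise is a basis. -/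
theorem IsBergmanBasis.of_hasSum {n : ℕ} {G : Set (Fin n → ℂ)} (hG : MeasurableSet G)
    {e : ℕ → (Fin n → ℂ) → ℂ} (hol : ∀ j, DifferentiableOn ℂ (e j) G)
    (hL : ∀ j, MemLp (e j) 2 (volume.restrict G))
    (horth : Orthonormal ℂ fun j => (hL j).toLp (e j))
    (hrep : ∀ (f : (Fin n → ℂ) → ℂ) (_ : DifferentiableOn ℂ f G)
      (hf : MemLp f 2 (volume.restrict G)), ∀ q ∈ G,
      HasSum (fun j => e j q * ⟪(hL j).toLp (e j), hf.toLp f⟫_ℂ) (f q)) :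
    IsBergmanBasis G e := by
  refine ⟨hol, hL, horth, fun f hd hf => ?_⟩
  set E : ℕ → Lp ℂ 2 (volume.restrict G) := fun j => (hL j).toLp (e j) with hE
  obtain ⟨y, hy⟩ := horth.summable_smul (horth.inner_products_summable (x := hf.toLp f))
  have hmem : y ∈ (Submodule.span ℂ (Set.range E)).topologicalClosure := by
    refine (Submodule.isClosed_topologicalClosure _).mem_of_tendsto hy
      (Filter.Eventually.of_forall fun s => ?_)
    exact Submodule.sum_mem _ fun j _ => Submodule.smul_mem _ _
      (Submodule.le_topologicalClosure _ (Submodule.subset_span ⟨j, rfl⟩))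
  suffices hf.toLp f = y by rwa [this]
  -- The Fourier series of `f` converges to `y` in `L²`, hence almost everywhere along a
  -- subsequence; by `hrep` the same partial sums converge pointwise to `f`.
  obtain ⟨ns, hns, hlim⟩ := (tendstoInMeasure_of_tendsto_Lp hy.tendsto_sum_nat).exists_seq_tendsto_ae
  refine Lp.ext ?_
  have hpart := ae_all_iff.2 fun N =>
    coeFn_sum_smul_toLp hL (fun j => ⟪E j, hf.toLp f⟫_ℂ) (Finset.range N)
  filter_upwards [hlim, hpart, hf.coeFn_toLp, ae_restrict_mem hG] with q h1 h2 h3 h4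
  rw [h3]
  have h5 := (hrep f hd hf q h4).tendsto_sum_nat.comp hns.tendsto_atTop
  refine tendsto_nhds_unique h5 ?_
  exact h1.congr fun i => h2 (ns i)

/-! ### Polar coordinates and orthogonality of powers on circles and discs. -/

theorem integrableOn_comp_polarCoord_symm {f : ℝ × ℝ → ℂ} (hf : Integrable f) :
    IntegrableOn (fun p => p.1 • f (polarCoord.symm p)) polarCoord.target := by
  have h := (integrableOn_image_iff_integrableOn_abs_det_fderiv_smul volume
    polarCoord.open_target.measurableSet
    (fun p _ => (hasFDerivAt_polarCoord_symm p).hasFDerivWithinAt)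
    polarCoord.symm.injOn f).1 hf.integrableOn
  refine h.congr_fun (fun x hx => ?_) polarCoord.open_target.measurableSet
  simp only [det_fderivPolarCoordSymm]
  rw [abs_of_pos hx.1]

theorem Complex.integrableOn_comp_polarCoord_symm {f : ℂ → ℂ} (hf : Integrable f) :
    IntegrableOn (fun p => p.1 • f (Complex.polarCoord.symm p)) polarCoord.target := by
  have h := (Complex.volume_preserving_equiv_real_prod.symm).integrable_comp_emb
    Complex.measurableEquivRealProd.symm.measurableEmbedding |>.2 hf
  exact _root_.integrableOn_comp_polarCoord_symm h

theorem Complex.integral_eq_iterated_polar {f : ℂ → ℂ} (hf : Integrable f) :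
    ∫ z, f z = ∫ r in Set.Ioi (0 : ℝ), ∫ θ in Set.Ioo (-Real.pi) Real.pi,
      (r : ℂ) * f (r * Complex.exp (θ * Complex.I)) := by
  have h := Complex.integrableOn_comp_polarCoord_symm hf
  rw [← Complex.integral_comp_polarCoord_symm]
  rw [polarCoord_target, Measure.volume_eq_prod] at h ⊢
  rw [setIntegral_prod _ h]
  simp [Complex.exp_mul_I]

theorem integral_exp_int_mul_I (m : ℤ) :
    ∫ θ in Set.Ioo (-Real.pi) Real.pi, Complex.exp (m * (θ * Complex.I)) =
      if m = 0 then (2 * Real.pi : ℂ) else 0 := by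
  rw [← integral_Ioc_eq_integral_Ioo,
    ← intervalIntegral.integral_of_le (by linarith [Real.pi_pos])]
  split_ifs with hm
  · subst hm
    simp [two_mul]
  · have hm' : (m : ℂ) * Complex.I ≠ 0 := by simp [hm]
    have h := integral_exp_mul_complex (a := -Real.pi) (b := Real.pi) hm'
    have e : ∀ θ : ℝ, (m : ℂ) * Complex.I * θ = m * (θ * Complex.I) := fun θ => by ring
    simp only [e] at h
    rw [h, div_eq_zero_iff]
    left
    -- The exponents at the two endpoints differ by `m` periods `2πi`.
    rw [sub_eq_zero, Complex.exp_eq_exp_iff_exists_int]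
    exact ⟨m, by push_cast; ring⟩

/-- Fourier coefficients of a power series on a circle. -/
theorem integral_circle_conj_pow_mul {g : ℂ → ℂ} {c : ℕ → ℂ} {r : ℝ} (hr : 0 ≤ r)
    (hg : ∀ z : ℂ, ‖z‖ = r → HasSum (fun n => c n * z ^ n) (g z)) (a : ℕ) :
    ∫ θ in Set.Ioo (-Real.pi) Real.pi,
      (starRingEnd ℂ) (r * Complex.exp (θ * Complex.I)) ^ a * g (r * Complex.exp (θ * Complex.I)) =
      2 * Real.pi * (c a * r ^ (2 * a)) := by
  set μ := (volume : Measure ℝ).restrict (Set.Ioo (-Real.pi) Real.pi) with hμ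
  have : IsFiniteMeasure μ := by
    constructor
    rw [hμ, Measure.restrict_apply_univ, Real.volume_Ioo]
    exact ENNReal.ofReal_lt_top
  set w : ℝ → ℂ := fun θ => r * Complex.exp (θ * Complex.I) with hw
  have hnorm : ∀ θ, ‖w θ‖ = r := fun θ => by
    simp [hw, Complex.norm_exp_ofReal_mul_I, abs_of_nonneg hr]
  set F : ℕ → ℝ → ℂ := fun n θ => c n * r ^ (n + a) *
    Complex.exp (((n : ℤ) - (a : ℤ) : ℤ) * (θ * Complex.I)) with hF
  have hFeq : ∀ n θ, (starRingEnd ℂ) (w θ) ^ a * (c n * w θ ^ n) = F n θ := fun n θ => by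
    simp only [hw, hF, map_mul, Complex.conj_ofReal, ← Complex.exp_conj, Complex.conj_I, mul_pow,
      ← Complex.exp_nat_mul]
    have : Complex.exp (((n : ℤ) - (a : ℤ) : ℤ) * (θ * Complex.I)) =
        Complex.exp (a * (θ * -Complex.I)) * Complex.exp (n * (θ * Complex.I)) := by
      rw [← Complex.exp_add]
      congr 1
      push_cast
      ring
    rw [this]
    ring
  have hFnorm : ∀ n θ, ‖F n θ‖ = ‖c n * (r : ℂ) ^ n‖ * r ^ a := fun n θ => by
    rw [← hFeq, norm_mul, norm_pow, RCLike.norm_conj, norm_mul (c n) (w θ ^ n), norm_pow (w θ) n, hnorm,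
      norm_mul (c n), norm_pow (r : ℂ) n, Complex.norm_real, Real.norm_of_nonneg hr]
    ring
  have hFcont : ∀ n, Continuous (F n) := fun n => by
    simp only [hF]
    fun_prop
  have hint : ∀ n, Integrable (F n) μ := fun n =>
    Integrable.of_bound (hFcont n).aestronglyMeasurable (‖c n * (r : ℂ) ^ n‖ * r ^ a)
      (Filter.Eventually.of_forall fun θ => (hFnorm n θ).le)
  -- The power series converges absolutely, with term norms constant on the circle, so it may be
  -- integrated term by term.
  have hsum : Summable fun n => ∫ θ, ‖F n θ‖ ∂μ := by
    simp only [hFnorm, integral_const, smul_eq_mul]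
    refine Summable.mul_left _ (Summable.mul_right _ ?_)
    exact (hg r (by simp [abs_of_nonneg hr])).summable.norm
  have h1 := hasSum_integral_of_summable_integral_norm hint hsum
  have h2 : ∀ θ, ∑' n, F n θ = (starRingEnd ℂ) (w θ) ^ a * g (w θ) := fun θ => by
    have := (hg (w θ) (hnorm θ)).mul_left ((starRingEnd ℂ) (w θ) ^ a)
    simp only [hFeq] at this
    exact this.tsum_eq
  simp only [h2] at h1
  refine h1.unique ?_
  have h3 : ∀ n, ∫ θ, F n θ ∂μ = if n = a then 2 * Real.pi * (c a * r ^ (2 * a)) else 0 := fun n => by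
    simp only [hF]
    rw [integral_const_mul, hμ, integral_exp_int_mul_I]
    by_cases h : n = a
    · subst h
      simp
      ring
    · have : ((n : ℤ) - (a : ℤ)) ≠ 0 := by omega
      simp [h, this]
  simp only [h3]
  exact hasSum_ite_eq a _

/-- Orthogonality of monomials on a disc with a radial weight. -/
theorem integral_ball_radial_mul_conj_pow_mul {g : ℂ → ℂ} {c : ℕ → ℂ} {R : ℝ} {ρ : ℝ → ℝ}
    (hg : ∀ z ∈ Metric.ball (0 : ℂ) R, HasSum (fun n => c n * z ^ n) (g z)) (a : ℕ)
    (hint : IntegrableOn (fun z => (ρ ‖z‖ : ℂ) * ((starRingEnd ℂ) z ^ a * g z)) (Metric.ball 0 R))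
    (hint' : IntegrableOn (fun z : ℂ => ρ ‖z‖ * ‖z‖ ^ (2 * a)) (Metric.ball 0 R)) :
    ∫ z in Metric.ball (0 : ℂ) R, (ρ ‖z‖ : ℂ) * ((starRingEnd ℂ) z ^ a * g z) =
      c a * ((∫ z in Metric.ball (0 : ℂ) R, ρ ‖z‖ * ‖z‖ ^ (2 * a) : ℝ) : ℂ) := by
  rw [← integral_complex_ofReal, ← integral_const_mul]
  have hint'' : IntegrableOn (fun z : ℂ => c a * ((ρ ‖z‖ * ‖z‖ ^ (2 * a) : ℝ) : ℂ))
      (Metric.ball 0 R) := (hint'.ofReal).const_mul _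
  rw [← integral_indicator measurableSet_ball, ← integral_indicator measurableSet_ball,
    Complex.integral_eq_iterated_polar (hint.integrable_indicator measurableSet_ball),
    Complex.integral_eq_iterated_polar (hint''.integrable_indicator measurableSet_ball)]
  -- The angular integrals already agree for each radius, since the weight is constant on circles.
  refine setIntegral_congr_fun measurableSet_Ioi fun r (hr : 0 < r) => ?_
  have hnorm : ∀ θ : ℝ, ‖(r : ℂ) * Complex.exp (θ * Complex.I)‖ = r := fun θ => by
    simp [Complex.norm_exp_ofReal_mul_I, abs_of_pos hr]
  by_cases hrR : r < R
  · have hmem : ∀ θ : ℝ, (r : ℂ) * Complex.exp (θ * Complex.I) ∈ Metric.ball (0 : ℂ) R :=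
      fun θ => by rw [mem_ball_zero_iff, hnorm]; exact hrR
    simp only [Set.indicator_of_mem (hmem _), hnorm]
    simp only [integral_const_mul]
    rw [integral_circle_conj_pow_mul hr.le (fun z hz => hg z (by simpa [hz] using hrR)) a]
    rw [setIntegral_const]
    rw [Real.volume_real_Ioo_of_le (by linarith [Real.pi_pos]), Complex.real_smul]
    push_cast
    ring
  · have hmem : ∀ θ : ℝ, (r : ℂ) * Complex.exp (θ * Complex.I) ∉ Metric.ball (0 : ℂ) R :=
      fun θ => by rw [mem_ball_zero_iff, hnorm]; exact hrR
    simp only [Set.indicator_of_notMem (hmem _)]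

/-! ### Holomorphic dependence of circle integrals on a parameter. -/

theorem hasDerivAt_vecCons_left (z w : ℂ) :
    HasDerivAt (fun z : ℂ => (![z, w] : Fin 2 → ℂ)) (Pi.single 0 1) z := by
  rw [hasDerivAt_pi]
  intro i
  fin_cases i
  · simpa using hasDerivAt_id' z
  · simpa using hasDerivAt_const z w

theorem hasDerivAt_vecCons_right (z w : ℂ) :
    HasDerivAt (fun w : ℂ => (![z, w] : Fin 2 → ℂ)) (Pi.single 1 1) w := by
  rw [hasDerivAt_pi]
  intro i
  fin_cases i
  · simpa using hasDerivAt_const w z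
  · simpa using hasDerivAt_id' w

theorem continuous_vecCons_prod : Continuous fun x : ℂ × ℂ => (![x.1, x.2] : Fin 2 → ℂ) := by
  refine continuous_pi fun i => ?_
  fin_cases i
  · exact continuous_fst
  · exact continuous_snd

/-- Integrals over a circle in the second variable depend holomorphically on the first one. -/
theorem differentiableAt_integral_circle {f : (Fin 2 → ℂ) → ℂ} {U : Set (Fin 2 → ℂ)}
    (hU : IsOpen U) (hf : DifferentiableOn ℂ f U) {κ : ℝ → ℂ} (hκ : Continuous κ) {z₀ : ℂ}
    {δ r : ℝ} (hδ : 0 < δ) (hr : 0 ≤ r)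
    (hsub : ∀ z ∈ Metric.closedBall z₀ δ, ∀ w : ℂ, ‖w‖ = r → ![z, w] ∈ U) :
    DifferentiableAt ℂ (fun z => ∫ θ in Set.Ioo (-Real.pi) Real.pi,
      κ θ * f ![z, r * Complex.exp (θ * Complex.I)]) z₀ := by
  set w : ℝ → ℂ := fun θ => r * Complex.exp (θ * Complex.I) with hw
  have hwc : Continuous w := by simp only [hw]; fun_prop
  have hnorm : ∀ θ, ‖w θ‖ = r := fun θ => by
    simp [hw, Complex.norm_exp_ofReal_mul_I, abs_of_nonneg hr]
  have hderiv : ∀ z ∈ Metric.closedBall z₀ δ, ∀ θ, HasDerivAt (fun z => f ![z, w θ])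
      (fderiv ℂ f ![z, w θ] (Pi.single 0 1)) z := fun z hz θ =>
    ((hf.differentiableAt (hU.mem_nhds (hsub z hz _ (hnorm θ)))).hasFDerivAt).comp_hasDerivAt z
      (hasDerivAt_vecCons_left z (w θ))
  obtain ⟨M, hM⟩ : ∃ M, ∀ z ∈ Metric.closedBall z₀ δ, ∀ θ, ‖f ![z, w θ]‖ ≤ M := by
    have hcpt : IsCompact ((fun x : ℂ × ℂ => (![x.1, x.2] : Fin 2 → ℂ)) ''
        (Metric.closedBall z₀ δ ×ˢ Metric.sphere 0 r)) :=
      ((isCompact_closedBall _ _).prod (isCompact_sphere _ _)).image continuous_vecCons_prod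
    obtain ⟨M, hM⟩ := hcpt.exists_bound_of_continuousOn (f := f) (hf.continuousOn.mono (by
      rintro _ ⟨x, hx, rfl⟩
      exact hsub _ hx.1 _ (by simpa using hx.2)))
    exact ⟨M, fun z hz θ => hM _ ⟨(z, w θ), ⟨hz, by simp [hnorm]⟩, rfl⟩⟩
  obtain ⟨κM, hκM⟩ := (isCompact_Icc (a := -Real.pi) (b := Real.pi)).exists_bound_of_continuousOn
    hκ.continuousOn
  have hcont : ∀ z ∈ Metric.closedBall z₀ δ, Continuous fun θ => κ θ * f ![z, w θ] := by
    intro z hz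
    refine hκ.mul (hf.continuousOn.comp_continuous
      (continuous_vecCons_prod.comp (continuous_const.prodMk hwc)) fun θ => ?_)
    exact hsub z hz _ (hnorm θ)
  have hball : Metric.ball z₀ (δ / 2) ⊆ Metric.closedBall z₀ δ :=
    Metric.ball_subset_closedBall.trans (Metric.closedBall_subset_closedBall (by linarith))
  set μ := (volume : Measure ℝ).restrict (Set.Ioo (-Real.pi) Real.pi) with hμ
  have : IsFiniteMeasure μ := by
    constructor
    rw [hμ, Measure.restrict_apply_univ, Real.volume_Ioo]
    exact ENNReal.ofReal_lt_top
  have hz₀ : z₀ ∈ Metric.closedBall z₀ δ := Metric.mem_closedBall_self hδ.le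
  have h := hasDerivAt_integral_of_dominated_loc_of_deriv_le (μ := μ) (x₀ := z₀)
    (F := fun z θ => κ θ * f ![z, w θ])
    (F' := fun z θ => κ θ * fderiv ℂ f ![z, w θ] (Pi.single 0 1))
    -- Cauchy's estimate on discs of radius `δ / 2`: those centred in `ball z₀ (δ / 2)` stay in
    -- `closedBall z₀ δ`, where `f` is bounded by `M`.
    (bound := fun _ => κM * (M / (δ / 2)))
    (Metric.ball_mem_nhds z₀ (half_pos hδ)) ?_ ?_ ?_ ?_ (integrable_const _) ?_
  · exact h.2.differentiableAt
  · filter_upwards [Metric.closedBall_mem_nhds z₀ hδ] with z hz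
    exact (hcont z hz).aestronglyMeasurable
  · refine Integrable.of_bound (hcont z₀ hz₀).aestronglyMeasurable (κM * M) ?_
    filter_upwards [ae_restrict_mem measurableSet_Ioo] with θ hθ
    rw [norm_mul]
    exact mul_le_mul (hκM θ (Set.Ioo_subset_Icc_self hθ)) (hM z₀ hz₀ θ) (norm_nonneg _)
      ((norm_nonneg _).trans (hκM θ (Set.Ioo_subset_Icc_self hθ)))
  · refine (hκ.measurable.mul ?_).aestronglyMeasurable
    exact (measurable_fderiv_apply_const ℂ f _).comp
      (continuous_vecCons_prod.comp (continuous_const.prodMk hwc)).measurable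
  · filter_upwards [ae_restrict_mem measurableSet_Ioo] with θ hθ z hz
    rw [norm_mul]
    refine mul_le_mul (hκM θ (Set.Ioo_subset_Icc_self hθ)) ?_ (norm_nonneg _)
      ((norm_nonneg _).trans (hκM θ (Set.Ioo_subset_Icc_self hθ)))
    have hsub' : Metric.closedBall z (δ / 2) ⊆ Metric.closedBall z₀ δ := by
      refine Metric.closedBall_subset_closedBall' ?_
      have := Metric.mem_ball.1 hz
      linarith
    rw [← (hderiv z (hball hz) θ).deriv]
    refine Complex.norm_deriv_le_of_forall_mem_sphere_norm_le (half_pos hδ) ?_ fun x hx =>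
      hM x (hsub' (Metric.sphere_subset_closedBall hx)) θ
    refine DifferentiableOn.diffContOnCl fun x hx => ?_
    have hx' := Metric.closure_ball_subset_closedBall hx
    exact ((hderiv x (hsub' hx') θ).differentiableAt).differentiableWithinAt
  · filter_upwards with θ z hz
    exact (hderiv z (hball hz) θ).const_mul _

/-! ### Slices, power series and Fubini's theorem on the ellipsoid. -/

section Ellipsoid

variable {p : ℝ}

/-- The radius of the slice of the ellipsoid over `z` with `‖z‖ = r`. -/
noncomputable def sliceRadius (p r : ℝ) : ℝ := (1 - r ^ 2) ^ (1 / (2 * p))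

/-- This presents the ellipsoid as a family of discs over the unit disc. The bound on `‖q 0‖` must
be kept on the right, because a real power of a negative base carries no information. -/
theorem mem_ellipsoid_iff (hp : 0 < p) {q : Fin 2 → ℂ} :
    q ∈ ellipsoid p ↔ ‖q 0‖ < 1 ∧ ‖q 1‖ < sliceRadius p ‖q 0‖ := by
  have key : ‖q 1‖ ^ (2 * p) < 1 - ‖q 0‖ ^ 2 ↔ 0 < 1 - ‖q 0‖ ^ 2 ∧
      ‖q 1‖ < sliceRadius p ‖q 0‖ := by
    constructor
    · intro h
      have h0 : 0 < 1 - ‖q 0‖ ^ 2 := (Real.rpow_nonneg (norm_nonneg _) _).trans_lt h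
      refine ⟨h0, ?_⟩
      rw [sliceRadius, one_div, Real.lt_rpow_inv_iff_of_pos (norm_nonneg _) h0.le (by positivity)]
      exact h
    · rintro ⟨h0, h⟩
      rwa [sliceRadius, one_div, Real.lt_rpow_inv_iff_of_pos (norm_nonneg _) h0.le (by positivity)]
        at h
  have h1 : 0 < 1 - ‖q 0‖ ^ 2 ↔ ‖q 0‖ < 1 := by
    rw [sub_pos, sq_lt_one_iff₀ (norm_nonneg _)]
  rw [← h1, ← key]
  simp only [ellipsoid, Set.mem_ofPred_eq]
  constructor <;> intro h <;> linarith

theorem sliceRadius_pos (p : ℝ) {r : ℝ} (hr0 : 0 ≤ r) (hr : r < 1) : 0 < sliceRadius p r :=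
  Real.rpow_pos_of_pos (sub_pos.2 ((sq_lt_one_iff₀ hr0).2 hr)) _

theorem isOpen_ellipsoid (hp : 0 < p) : IsOpen (ellipsoid p) := by
  refine isOpen_lt ?_ continuous_const
  exact ((continuous_apply 0).norm.pow 2).add
    ((continuous_apply 1).norm.rpow_const fun _ => Or.inr (by positivity))

theorem vecCons_mem_ellipsoid (hp : 0 < p) {z w : ℂ} (hz : z ∈ Metric.ball (0 : ℂ) 1)
    (hw : w ∈ Metric.ball (0 : ℂ) (sliceRadius p ‖z‖)) : ![z, w] ∈ ellipsoid p := by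
  rw [mem_ellipsoid_iff hp]
  exact ⟨by simpa using hz, by simpa using hw⟩

/-- The power series expansion of a holomorphic function on the ellipsoid. -/
theorem exists_hasSum_of_differentiableOn_ellipsoid (hp : 0 < p) {f : (Fin 2 → ℂ) → ℂ}
    (hf : DifferentiableOn ℂ f (ellipsoid p)) :
    ∃ (F : ℕ → ℂ → ℂ) (c : ℕ → ℕ → ℂ),
      (∀ z ∈ Metric.ball (0 : ℂ) 1, ∀ w ∈ Metric.ball (0 : ℂ) (sliceRadius p ‖z‖),
        HasSum (fun b => F b z * w ^ b) (f ![z, w])) ∧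
      ∀ b, ∀ z ∈ Metric.ball (0 : ℂ) 1, HasSum (fun a => c a b * z ^ a) (F b z) := by
  have hopen := isOpen_ellipsoid hp
  set F : ℕ → ℂ → ℂ := fun b z => (b.factorial : ℂ)⁻¹ * iteratedDeriv b (fun w => f ![z, w]) 0
    with hF
  have hFsum : ∀ z ∈ Metric.ball (0 : ℂ) 1, ∀ w ∈ Metric.ball (0 : ℂ) (sliceRadius p ‖z‖),
      HasSum (fun b => F b z * w ^ b) (f ![z, w]) := by
    intro z hz w hw
    have hd : DifferentiableOn ℂ (fun w => f ![z, w]) (Metric.ball 0 (sliceRadius p ‖z‖)) := by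
      intro w hw
      have := (hf.differentiableAt (hopen.mem_nhds (vecCons_mem_ellipsoid hp hz hw)))
      exact (this.comp w
        (hasDerivAt_vecCons_right z w).differentiableAt).differentiableWithinAt
    refine (Complex.hasSum_taylorSeries_on_ball hd hw).congr_fun fun b => ?_
    simp only [hF, smul_eq_mul, sub_zero]
    ring
  -- Near a given `z₀` one circle `|w| = r` lies in all slices, and there `F b` is a multiple of an
  -- integral over that circle, hence holomorphic.
  have hFd : ∀ b, DifferentiableOn ℂ (F b) (Metric.ball 0 1) := by
    intro b z₀ hz₀
    obtain ⟨δ, r, hδ, hr, hsub⟩ : ∃ δ r : ℝ, 0 < δ ∧ 0 < r ∧ ∀ z ∈ Metric.closedBall z₀ δ,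
        z ∈ Metric.ball (0 : ℂ) 1 ∧ r < sliceRadius p ‖z‖ := by
      have hlt : ‖z₀‖ < 1 := by simpa using hz₀
      have hpos := sliceRadius_pos p (norm_nonneg z₀) hlt
      have hc : ContinuousAt (fun z : ℂ => sliceRadius p ‖z‖) z₀ := by
        unfold sliceRadius
        refine ContinuousAt.rpow_const (by fun_prop) (Or.inl ?_)
        have := (sq_lt_one_iff₀ (norm_nonneg z₀)).2 hlt
        linarith
      have hev : ∀ᶠ z in nhds z₀, z ∈ Metric.ball (0 : ℂ) 1 ∧
          sliceRadius p ‖z₀‖ / 2 < sliceRadius p ‖z‖ :=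
        Filter.Eventually.and (Metric.isOpen_ball.mem_nhds hz₀)
          (hc.eventually (lt_mem_nhds (half_lt_self hpos)))
      obtain ⟨δ, hδ, h⟩ := Metric.nhds_basis_closedBall.mem_iff.1 hev
      exact ⟨δ, _, hδ, half_pos hpos, fun z hz => h hz⟩
    have hdiff := differentiableAt_integral_circle hopen hf
      (κ := fun θ => (starRingEnd ℂ) (r * Complex.exp (θ * Complex.I)) ^ b)
      (Continuous.pow (Complex.continuous_conj.comp (by fun_prop)) b) hδ hr.le
      (fun z hz w hw => vecCons_mem_ellipsoid hp (hsub z hz).1 (by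
        simpa [hw] using (hsub z hz).2))
    have heq : F b =ᶠ[nhds z₀] fun z => (2 * Real.pi * (r : ℂ) ^ (2 * b))⁻¹ *
        ∫ θ in Set.Ioo (-Real.pi) Real.pi, (starRingEnd ℂ) (r * Complex.exp (θ * Complex.I)) ^ b *
          f ![z, r * Complex.exp (θ * Complex.I)] := by
      filter_upwards [Metric.closedBall_mem_nhds z₀ hδ] with z hz
      rw [integral_circle_conj_pow_mul (g := fun w => f ![z, w]) (c := fun b => F b z) hr.le
        (fun w hw => hFsum z (hsub z hz).1 w (by simpa [hw] using (hsub z hz).2)) b]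
      have : (2 * Real.pi * (r : ℂ) ^ (2 * b)) ≠ 0 := by
        have := Real.pi_ne_zero
        have := hr.ne'
        simp [*]
      field_simp
    exact ((hdiff.const_mul _).congr_of_eventuallyEq heq).differentiableWithinAt
  refine ⟨F, fun a b => (a.factorial : ℂ)⁻¹ * iteratedDeriv a (F b) 0, hFsum, fun b z hz => ?_⟩
  refine (Complex.hasSum_taylorSeries_on_ball (hFd b) hz).congr_fun fun a => ?_
  simp only [smul_eq_mul, sub_zero]
  ring

/-- Fubini's theorem on the ellipsoid. -/
theorem ellipsoid_fubini (hp : 0 < p) {V : Type*} [NormedAddCommGroup V] [NormedSpace ℝ V]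
    {f : (Fin 2 → ℂ) → V} (hf : IntegrableOn f (ellipsoid p)) :
    (∀ᵐ z ∂volume.restrict (Metric.ball (0 : ℂ) 1),
      IntegrableOn (fun w => f ![z, w]) (Metric.ball 0 (sliceRadius p ‖z‖))) ∧
    IntegrableOn (fun z => ∫ w in Metric.ball (0 : ℂ) (sliceRadius p ‖z‖), f ![z, w])
      (Metric.ball 0 1) ∧
    ∫ q in ellipsoid p, f q = ∫ z in Metric.ball (0 : ℂ) 1,
      ∫ w in Metric.ball (0 : ℂ) (sliceRadius p ‖z‖), f ![z, w] := by
  have hmeas := (isOpen_ellipsoid hp).measurableSet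
  have hmp := (volume_preserving_finTwoArrow ℂ).symm
  have hemb := (MeasurableEquiv.finTwoArrow (α := ℂ)).symm.measurableEmbedding
  have harrow : ∀ x : ℂ × ℂ, MeasurableEquiv.finTwoArrow.symm x = ![x.1, x.2] := fun x => rfl
  have hint := (hmp.integrable_comp_emb hemb).2 (hf.integrable_indicator hmeas)
  rw [Measure.volume_eq_prod] at hint
  have hin : ∀ z ∈ Metric.ball (0 : ℂ) 1, (fun w => (ellipsoid p).indicator f ![z, w]) =
      (Metric.ball (0 : ℂ) (sliceRadius p ‖z‖)).indicator fun w => f ![z, w] := by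
    intro z hz
    funext w
    have : ![z, w] ∈ ellipsoid p ↔ w ∈ Metric.ball (0 : ℂ) (sliceRadius p ‖z‖) := by
      have hz' : ‖z‖ < 1 := by simpa using hz
      rw [mem_ellipsoid_iff hp]
      simp [hz']
    by_cases h : w ∈ Metric.ball (0 : ℂ) (sliceRadius p ‖z‖)
    · rw [Set.indicator_of_mem h, Set.indicator_of_mem (this.2 h)]
    · rw [Set.indicator_of_notMem h, Set.indicator_of_notMem (mt this.1 h)]
  have hout : ∀ z ∉ Metric.ball (0 : ℂ) 1, ∀ w, (ellipsoid p).indicator f ![z, w] = 0 := by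
    intro z hz w
    refine Set.indicator_of_notMem (fun h => hz ?_) _
    simpa using ((mem_ellipsoid_iff hp).1 h).1
  have hiter : (fun z => ∫ w, (ellipsoid p).indicator f ![z, w]) =
      (Metric.ball (0 : ℂ) 1).indicator fun z =>
        ∫ w in Metric.ball (0 : ℂ) (sliceRadius p ‖z‖), f ![z, w] := by
    funext z
    by_cases hz : z ∈ Metric.ball (0 : ℂ) 1
    · rw [Set.indicator_of_mem hz, hin z hz, integral_indicator measurableSet_ball]
    · rw [Set.indicator_of_notMem hz]
      simp [hout z hz]
  refine ⟨?_, ?_, ?_⟩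
  · have h := hint.prod_right_ae
    filter_upwards [ae_restrict_of_ae h, ae_restrict_mem measurableSet_ball] with z hz hzb
    simp only [Function.comp_def, harrow] at hz
    rw [hin z hzb] at hz
    exact (integrable_indicator_iff measurableSet_ball).1 hz
  · have h := hint.integral_prod_left
    simp only [Function.comp_def, harrow] at h
    rw [hiter] at h
    exact (integrable_indicator_iff measurableSet_ball).1 h
  · rw [← integral_indicator hmeas, ← hmp.integral_comp hemb, Measure.volume_eq_prod,
      ← integral_indicator measurableSet_ball, ← hiter]
    exact integral_prod _ hint

/-! ### Monomials: orthogonality, norms and normalization. -/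

/-- The monomial `z^a w^b`, indexed by `(b, a)`. -/
def ellipsoidMonomial (j : ℕ × ℕ) (q : Fin 2 → ℂ) : ℂ := q 0 ^ j.2 * q 1 ^ j.1

/-- The squared norm of `z^a w^b` in the Bergman space. -/
noncomputable def monomialNormSq (p : ℝ) (j : ℕ × ℕ) : ℝ :=
  ∫ q in ellipsoid p, ‖q 0‖ ^ (2 * j.2) * ‖q 1‖ ^ (2 * j.1)

theorem norm_le_one_of_mem_ellipsoid (hp : 0 < p) {q : Fin 2 → ℂ} (hq : q ∈ ellipsoid p)
    (i : Fin 2) : ‖q i‖ ≤ 1 := by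
  have h := (mem_ellipsoid_iff hp).1 hq
  fin_cases i
  · exact h.1.le
  · refine h.2.le.trans (Real.rpow_le_one ?_ ?_ (by positivity))
    · have := (sq_lt_one_iff₀ (norm_nonneg (q 0))).2 h.1
      linarith
    · have := sq_nonneg ‖q 0‖
      linarith

theorem isFiniteMeasure_ellipsoid (hp : 0 < p) :
    IsFiniteMeasure (volume.restrict (ellipsoid p)) := by
  constructor
  rw [Measure.restrict_apply_univ]
  refine (Metric.isBounded_closedBall (x := (0 : Fin 2 → ℂ)) (r := 1)).subset ?_ |>.measure_lt_top
  intro q hq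
  rw [mem_closedBall_zero_iff, pi_norm_le_iff_of_nonneg zero_le_one]
  exact norm_le_one_of_mem_ellipsoid hp hq

theorem continuous_ellipsoidMonomial (j : ℕ × ℕ) : Continuous (ellipsoidMonomial j) := by
  unfold ellipsoidMonomial; fun_prop

theorem differentiable_ellipsoidMonomial (j : ℕ × ℕ) : Differentiable ℂ (ellipsoidMonomial j) := by
  unfold ellipsoidMonomial; fun_prop

theorem norm_ellipsoidMonomial_le (hp : 0 < p) (j : ℕ × ℕ) {q : Fin 2 → ℂ}
    (hq : q ∈ ellipsoid p) : ‖ellipsoidMonomial j q‖ ≤ 1 := by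
  rw [ellipsoidMonomial, norm_mul, norm_pow, norm_pow]
  exact mul_le_one₀ (pow_le_one₀ (norm_nonneg _) (norm_le_one_of_mem_ellipsoid hp hq 0))
    (by positivity) (pow_le_one₀ (norm_nonneg _) (norm_le_one_of_mem_ellipsoid hp hq 1))

theorem memLp_ellipsoidMonomial (hp : 0 < p) (j : ℕ × ℕ) :
    MemLp (ellipsoidMonomial j) 2 (volume.restrict (ellipsoid p)) := by
  have := isFiniteMeasure_ellipsoid hp
  refine MemLp.of_bound (continuous_ellipsoidMonomial j).aestronglyMeasurable 1 ?_
  filter_upwards [ae_restrict_mem (isOpen_ellipsoid hp).measurableSet] with q hq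
  exact norm_ellipsoidMonomial_le hp j hq

theorem integrableOn_monomialNormSq (hp : 0 < p) (j : ℕ × ℕ) :
    IntegrableOn (fun q : Fin 2 → ℂ => ‖q 0‖ ^ (2 * j.2) * ‖q 1‖ ^ (2 * j.1)) (ellipsoid p) := by
  refine ((memLp_ellipsoidMonomial hp j).integrable_norm_pow (by norm_num)).congr
    (Filter.Eventually.of_forall fun q => ?_)
  simp only [ellipsoidMonomial, norm_mul, norm_pow]
  ring

/-- Integration against a monomial picks out a coefficient of the power series. -/
theorem integral_conj_ellipsoidMonomial_mul (hp : 0 < p) {f : (Fin 2 → ℂ) → ℂ}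
    (hf : MemLp f 2 (volume.restrict (ellipsoid p))) {F : ℕ → ℂ → ℂ} {c : ℕ → ℕ → ℂ}
    (hF : ∀ z ∈ Metric.ball (0 : ℂ) 1, ∀ w ∈ Metric.ball (0 : ℂ) (sliceRadius p ‖z‖),
        HasSum (fun b => F b z * w ^ b) (f ![z, w]))
    (hc : ∀ b, ∀ z ∈ Metric.ball (0 : ℂ) 1, HasSum (fun a => c a b * z ^ a) (F b z))
    (j : ℕ × ℕ) :
    ∫ q in ellipsoid p, (starRingEnd ℂ) (ellipsoidMonomial j q) * f q =
      c j.2 j.1 * monomialNormSq p j := by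
  have hconj : ∀ j, IntegrableOn (fun q => (starRingEnd ℂ) (ellipsoidMonomial j q) * f q)
      (ellipsoid p) := fun j =>
    MemLp.integrable_mul (p := 2) (q := 2) (memLp_ellipsoidMonomial hp j).star hf
  obtain ⟨b, a⟩ := j
  set ρ : ℝ → ℝ := fun r => ∫ w in Metric.ball (0 : ℂ) (sliceRadius p r), ‖w‖ ^ (2 * b) with hρ
  have hslice : ∀ᵐ z ∂volume.restrict (Metric.ball (0 : ℂ) 1),
      ∫ w in Metric.ball (0 : ℂ) (sliceRadius p ‖z‖),
        (starRingEnd ℂ) (ellipsoidMonomial (b, a) ![z, w]) * f ![z, w] =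
      (ρ ‖z‖ : ℂ) * ((starRingEnd ℂ) z ^ a * F b z) := by
    -- The exponent `0` of `z` makes the slice integrand exactly `conj(w)^b f`; the factor
    -- `conj(z)^a` is constant on the slice. Integrating over `w` isolates `F b z` with the radial
    -- weight `ρ`, and integrating over `z` then isolates `c a b`.
    filter_upwards [(ellipsoid_fubini hp (hconj (b, 0))).1, ae_restrict_mem measurableSet_ball]
      with z hz hzb
    have h := integral_ball_radial_mul_conj_pow_mul (ρ := fun _ => 1) (hF z hzb) b
      (by simpa [ellipsoidMonomial] using hz) (by
        refine IntegrableOn.mono_set ?_ Metric.ball_subset_closedBall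
        exact ContinuousOn.integrableOn_compact (isCompact_closedBall _ _) (by fun_prop))
    simp only [Complex.ofReal_one, one_mul] at h
    have e : ∀ w : ℂ, (starRingEnd ℂ) (ellipsoidMonomial (b, a) ![z, w]) * f ![z, w] =
        (starRingEnd ℂ) z ^ a * ((starRingEnd ℂ) w ^ b * f ![z, w]) := fun w => by
      simp [ellipsoidMonomial]
      ring
    simp only [e]
    rw [integral_const_mul, h]
    ring
  obtain ⟨-, hI1, hI2⟩ := ellipsoid_fubini hp (hconj (b, a))
  obtain ⟨-, hN1, hN2⟩ := ellipsoid_fubini hp (integrableOn_monomialNormSq hp (b, a))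
  have hN : ∀ z : ℂ, ∫ w in Metric.ball (0 : ℂ) (sliceRadius p ‖z‖),
      ‖(![z, w] : Fin 2 → ℂ) 0‖ ^ (2 * a) * ‖(![z, w] : Fin 2 → ℂ) 1‖ ^ (2 * b) =
        ρ ‖z‖ * ‖z‖ ^ (2 * a) := fun z => by
    simp only [Matrix.cons_val_zero, Matrix.cons_val_one]
    rw [integral_const_mul, mul_comm]
  simp only [hN] at hN1 hN2
  rw [hI2, integral_congr_ae hslice, integral_ball_radial_mul_conj_pow_mul (hc b) a
    ((integrable_congr hslice).1 hI1) hN1, monomialNormSq, hN2]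

theorem integral_conj_ellipsoidMonomial_mul_ellipsoidMonomial (hp : 0 < p) (i j : ℕ × ℕ) :
    ∫ q in ellipsoid p, (starRingEnd ℂ) (ellipsoidMonomial i q) * ellipsoidMonomial j q =
      if i = j then (monomialNormSq p i : ℂ) else 0 := by
  rw [integral_conj_ellipsoidMonomial_mul hp (memLp_ellipsoidMonomial hp j)
    (F := fun b z => if b = j.1 then z ^ j.2 else 0)
    (c := fun a b => if a = j.2 then (if b = j.1 then 1 else 0) else 0)]
  · obtain ⟨i1, i2⟩ := i
    obtain ⟨j1, j2⟩ := j
    by_cases h1 : i1 = j1 <;> by_cases h2 : i2 = j2 <;> simp [h1, h2]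
  · intro z _ w _
    refine (hasSum_ite_eq j.1 (z ^ j.2 * w ^ j.1)).congr_fun fun b => ?_
    by_cases h : b = j.1 <;> simp [h]
  · intro b z _
    refine (hasSum_ite_eq j.2 (if b = j.1 then z ^ j.2 else 0)).congr_fun fun a => ?_
    by_cases h : a = j.2 <;> simp [h]

/-- Radial integrals on a disc. -/
theorem integral_ball_norm_sq (h : ℝ → ℝ) {R : ℝ} (hR : 0 ≤ R) :
    ∫ z in Metric.ball (0 : ℂ) R, h (‖z‖ ^ 2) = Real.pi * ∫ s in Set.Ioo 0 (R ^ 2), h s := by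
  have hind : ∀ z : ℂ, (Metric.ball (0 : ℂ) R).indicator (fun z => h (‖z‖ ^ 2)) z =
      (Set.Iio (R ^ 2)).indicator h (‖z‖ ^ 2) := fun z => by
    by_cases hz : ‖z‖ < R
    · rw [Set.indicator_of_mem (by simpa using hz),
        Set.indicator_of_mem (Set.mem_Iio.2 (by gcongr))]
    · rw [Set.indicator_of_notMem (by simpa using hz),
        Set.indicator_of_notMem (by rw [Set.mem_Iio, not_lt]; push Not at hz; gcongr)]
  rw [← integral_indicator measurableSet_ball]
  simp only [hind]
  rw [integral_fun_norm_addHaar volume fun r => (Set.Iio (R ^ 2)).indicator h (r ^ 2)]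
  -- The substitution `s = r²` absorbs the Jacobian `2r`.
  have h1 := integral_comp_rpow_Ioi (fun s => (Set.Iio (R ^ 2)).indicator h s) (p := 2) (by norm_num)
  have h2 : ∫ s in Set.Ioi (0 : ℝ), (Set.Iio (R ^ 2)).indicator h s = ∫ s in Set.Ioo 0 (R ^ 2), h s := by
    rw [setIntegral_indicator measurableSet_Iio, Set.Ioi_inter_Iio]
  rw [← h2, ← h1]
  have h3 : ∀ x : ℝ, (|(2 : ℝ)| * x ^ ((2 : ℝ) - 1)) • (Set.Iio (R ^ 2)).indicator h (x ^ (2 : ℝ)) =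
      2 * (x ^ (Module.finrank ℝ ℂ - 1) • (Set.Iio (R ^ 2)).indicator h (x ^ 2)) := fun x => by
    rw [Complex.finrank_real_complex]
    norm_num
    ring
  simp only [h3, integral_const_mul]
  rw [Complex.finrank_real_complex, Measure.real, Complex.volume_ball]
  simp
  ring

/-- This is the beta integral `B(a+1, m+1)`, a finite product because `a` is a natural number. -/
theorem integral_pow_mul_one_sub_rpow (a : ℕ) {m : ℝ} (hm : 0 < m) :
    ∫ s in Set.Ioo (0 : ℝ) 1, s ^ a * (1 - s) ^ m =
      a.factorial / ∏ j ∈ Finset.range (a + 1), (m + 1 + j) := by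
  have h := Complex.betaIntegral_eval_nat_add_one_right (u := ((m + 1 : ℝ) : ℂ))
    (by rw [Complex.ofReal_re]; linarith) a
  rw [← Complex.betaIntegral_symm, Complex.betaIntegral,
    intervalIntegral.integral_of_le zero_le_one, integral_Ioc_eq_integral_Ioo] at h
  have e : ∫ s in Set.Ioo (0 : ℝ) 1, (s : ℂ) ^ ((a : ℂ) + 1 - 1) *
      (1 - (s : ℂ)) ^ (((m + 1 : ℝ) : ℂ) - 1) =
      ((∫ s in Set.Ioo (0 : ℝ) 1, s ^ a * (1 - s) ^ m : ℝ) : ℂ) := by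
    rw [← integral_complex_ofReal]
    refine setIntegral_congr_fun measurableSet_Ioo fun s hs => ?_
    have h1 : (0 : ℝ) ≤ 1 - s := by linarith [hs.2]
    simp only [add_sub_cancel_right, Complex.cpow_natCast, Complex.ofReal_add, Complex.ofReal_one,
      Complex.ofReal_mul, Complex.ofReal_pow, Complex.ofReal_cpow h1, Complex.ofReal_sub]
  rw [e] at h
  exact_mod_cast h

/-- The slice integral of `|w|^(2b)` is `π/(b+1) · (1-|z|²)^((b+1)/p)`, which leaves a beta integral
in `|z|²`. -/
theorem monomialNormSq_eq (hp : 0 < p) (j : ℕ × ℕ) :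
    monomialNormSq p j = Real.pi ^ 2 / (j.1 + 1) *
      (j.2.factorial / ∏ i ∈ Finset.range (j.2 + 1), ((j.1 + 1) / p + 1 + i)) := by
  obtain ⟨b, a⟩ := j
  rw [monomialNormSq, (ellipsoid_fubini hp (integrableOn_monomialNormSq hp (b, a))).2.2,
    ← integral_pow_mul_one_sub_rpow a (m := (b + 1) / p) (by positivity)]
  have h1 : ∀ z ∈ Metric.ball (0 : ℂ) 1, ∫ w in Metric.ball (0 : ℂ) (sliceRadius p ‖z‖),
      ‖(![z, w] : Fin 2 → ℂ) 0‖ ^ (2 * a) * ‖(![z, w] : Fin 2 → ℂ) 1‖ ^ (2 * b) =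
      Real.pi / (b + 1) * ((‖z‖ ^ 2) ^ a * (1 - ‖z‖ ^ 2) ^ ((b + 1) / p)) := by
    intro z hz
    have hz' : ‖z‖ < 1 := by simpa using hz
    have hpos : 0 < 1 - ‖z‖ ^ 2 := sub_pos.2 ((sq_lt_one_iff₀ (norm_nonneg z)).2 hz')
    have hR := sliceRadius_pos p (norm_nonneg z) hz'
    simp only [Matrix.cons_val_zero, Matrix.cons_val_one, pow_mul]
    rw [integral_const_mul, integral_ball_norm_sq (fun s => s ^ b) hR.le,
      ← integral_Ioc_eq_integral_Ioo, ← intervalIntegral.integral_of_le (sq_nonneg _), integral_pow]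
    have e : (sliceRadius p ‖z‖ ^ 2) ^ (b + 1) = (1 - ‖z‖ ^ 2) ^ ((b + 1) / p) := by
      rw [← pow_mul, sliceRadius, ← Real.rpow_natCast, ← Real.rpow_mul hpos.le]
      congr 1
      push_cast
      field_simp
    rw [e, zero_pow (Nat.succ_ne_zero b)]
    ring
  rw [setIntegral_congr_fun measurableSet_ball h1, integral_const_mul,
    integral_ball_norm_sq (fun s => s ^ a * (1 - s) ^ ((b + 1) / p)) zero_le_one, one_pow]
  ring

theorem monomialNormSq_pos (hp : 0 < p) (j : ℕ × ℕ) : 0 < monomialNormSq p j := by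
  rw [monomialNormSq_eq hp]
  have : 0 < ∏ i ∈ Finset.range (j.2 + 1), (((j.1 : ℝ) + 1) / p + 1 + i) :=
    Finset.prod_pos fun i _ => by positivity
  positivity

theorem inner_toLp_eq_integral {α : Type*} [MeasurableSpace α] {μ : Measure α} {f g : α → ℂ}
    (hf : MemLp f 2 μ) (hg : MemLp g 2 μ) :
    ⟪hf.toLp f, hg.toLp g⟫_ℂ = ∫ x, (starRingEnd ℂ) (f x) * g x ∂μ := by
  rw [L2.inner_def]
  refine integral_congr_ae ?_
  filter_upwards [hf.coeFn_toLp, hg.coeFn_toLp] with x h1 h2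
  rw [h1, h2, RCLike.inner_apply, mul_comm]

/-- The normalized monomials. -/
noncomputable def ellipsoidBasis (p : ℝ) (n : ℕ) (q : Fin 2 → ℂ) : ℂ :=
  ((√(monomialNormSq p n.unpair))⁻¹ : ℝ) * ellipsoidMonomial n.unpair q

theorem memLp_ellipsoidBasis (hp : 0 < p) (n : ℕ) :
    MemLp (ellipsoidBasis p n) 2 (volume.restrict (ellipsoid p)) :=
  (memLp_ellipsoidMonomial hp n.unpair).const_mul _

theorem inner_ellipsoidBasis (hp : 0 < p) (n : ℕ) {f : (Fin 2 → ℂ) → ℂ}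
    (hf : MemLp f 2 (volume.restrict (ellipsoid p))) :
    ⟪(memLp_ellipsoidBasis hp n).toLp _, hf.toLp f⟫_ℂ =
      ((√(monomialNormSq p n.unpair))⁻¹ : ℝ) *
        ∫ q in ellipsoid p, (starRingEnd ℂ) (ellipsoidMonomial n.unpair q) * f q := by
  rw [inner_toLp_eq_integral, ← integral_const_mul]
  simp only [ellipsoidBasis, map_mul, Complex.conj_ofReal, mul_assoc]

theorem orthonormal_ellipsoidBasis (hp : 0 < p) :
    Orthonormal ℂ fun n => (memLp_ellipsoidBasis hp n).toLp (ellipsoidBasis p n) := by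
  rw [orthonormal_iff_ite]
  intro i j
  rw [inner_ellipsoidBasis hp]
  have e : ∀ q, (starRingEnd ℂ) (ellipsoidMonomial i.unpair q) * ellipsoidBasis p j q =
      ((√(monomialNormSq p j.unpair))⁻¹ : ℝ) *
        ((starRingEnd ℂ) (ellipsoidMonomial i.unpair q) * ellipsoidMonomial j.unpair q) := fun q => by
    rw [ellipsoidBasis]; ring
  simp only [e]
  rw [integral_const_mul, integral_conj_ellipsoidMonomial_mul_ellipsoidMonomial hp]
  have hinj : i.unpair = j.unpair ↔ i = j := Nat.pairEquiv.symm.injective.eq_iff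
  by_cases h : i = j
  · subst h
    have hpos := monomialNormSq_pos hp i.unpair
    have hs : √(monomialNormSq p i.unpair) ≠ 0 := (Real.sqrt_pos.2 hpos).ne'
    simp only [if_true]
    rw [← Complex.ofReal_mul, ← Complex.ofReal_mul, ← Complex.ofReal_one, Complex.ofReal_inj]
    nth_rewrite 3 [← Real.mul_self_sqrt hpos.le]
    field_simp
  · rw [if_neg (mt hinj.1 h), if_neg h]
    simp

theorem ballDefect_pos (hp : 0 < p) {q : Fin 2 → ℂ} (hq : q ∈ ellipsoid p) : 0 < ballDefect q :=
  sub_pos.2 ((sq_lt_one_iff₀ (norm_nonneg _)).2 ((mem_ellipsoid_iff hp).1 hq).1)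

theorem ellipsoidRadial_nonneg {q : Fin 2 → ℂ} (hq : 0 < ballDefect q) :
    0 ≤ ellipsoidRadial p q := mul_nonneg (sq_nonneg _) (Real.rpow_nonneg hq.le _)

theorem ellipsoidRadial_lt_one (hp : 0 < p) {q : Fin 2 → ℂ} (hq : q ∈ ellipsoid p) :
    ellipsoidRadial p q < 1 := by
  have ht := ballDefect_pos hp hq
  have h := ((mem_ellipsoid_iff hp).1 hq).2
  have h1 : ‖q 1‖ ^ 2 < ballDefect q ^ (1 / p) := by
    have e : ballDefect q ^ (1 / p) = sliceRadius p ‖q 0‖ ^ 2 := by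
      rw [sliceRadius, ← Real.rpow_natCast, ← Real.rpow_mul (by exact ht.le), ballDefect]
      congr 1
      push_cast
      field_simp
    rw [e]
    gcongr
  rw [ellipsoidRadial, Real.rpow_neg ht.le, ← div_eq_mul_inv, div_lt_one (Real.rpow_pos_of_pos ht _)]
  exact h1

/-! ### The Bergman kernel in closed form. -/

/-- The Bergman kernel of the ellipsoid on the diagonal. -/
noncomputable def ellipsoidKernel (p : ℝ) (q : Fin 2 → ℂ) : ℝ :=
  ballDefect q ^ (-(2 + 1 / p)) * (((p + 1) + (1 - p) * ellipsoidRadial p q) /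
    (p * Real.pi ^ 2 * (1 - ellipsoidRadial p q) ^ 3))

theorem hasSum_binomial_one_sub {x s : ℝ} (hx0 : 0 ≤ x) (hx : x < 1) :
    HasSum (fun a : ℕ => (∏ i ∈ Finset.range a, (s + i)) / a.factorial * x ^ a)
      ((1 - x) ^ (-s)) := by
  have h := (Real.one_div_one_sub_rpow_hasFPowerSeriesOnBall_zero s).hasSum (y := x) (by
    rw [Metric.mem_eball, edist_zero_right, ← ofReal_norm, Real.norm_of_nonneg hx0]
    exact ENNReal.ofReal_lt_one.2 hx)
  simp only [FormalMultilinearSeries.ofScalars_apply_eq, zero_add, smul_eq_mul] at h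
  rw [Real.rpow_neg (by linarith), ← one_div]
  refine h.congr_fun fun a => ?_
  congr 1
  rw [Ring.choose_eq_smul, Polynomial.descPochhammer_smeval_eq_ascPochhammer,
    Polynomial.ascPochhammer_smeval_eq_eval, show s + a - 1 - a + 1 = s by ring, smul_eq_mul,
    inv_mul_eq_div]
  congr 1
  induction a with
  | zero => simp
  | succ a ih => rw [Finset.prod_range_succ, ih, ascPochhammer_succ_eval]

/-- The coefficient equals `(2/p) C(b+2,2) + ((p-1)/p) C(b+1,1)`, so two derivatives of the
geometric series suffice. -/
theorem hasSum_succ_mul {p u : ℝ} (hp : 0 < p) (hu : |u| < 1) :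
    HasSum (fun b : ℕ => ((b : ℝ) + 1) * ((b + 1) / p + 1) * u ^ b)
      (((p + 1) + (1 - p) * u) / (p * (1 - u) ^ 3)) := by
  have h1 := (hasSum_choose_mul_geometric_of_norm_lt_one 2 (r := u) hu).mul_left (2 / p)
  have h2 := (hasSum_choose_mul_geometric_of_norm_lt_one 1 (r := u) hu).mul_left ((p - 1) / p)
  have hne : 1 - u ≠ 0 := by have := (abs_lt.1 hu).2; linarith
  have e : ((p + 1) + (1 - p) * u) / (p * (1 - u) ^ 3) =
      2 / p * (1 / (1 - u) ^ (2 + 1)) + (p - 1) / p * (1 / (1 - u) ^ (1 + 1)) := by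
    field_simp
    ring
  rw [e]
  refine (h1.add h2).congr_fun fun b => ?_
  rw [Nat.choose_one_right, Nat.cast_choose_two]
  push_cast
  field_simp
  ring

theorem hasSum_ellipsoidKernel_pairs (hp : 0 < p) {q : Fin 2 → ℂ} (hq : q ∈ ellipsoid p) :
    HasSum (fun j : ℕ × ℕ => ‖ellipsoidMonomial j q‖ ^ 2 / monomialNormSq p j)
      (ellipsoidKernel p q) := by
  have ht := ballDefect_pos hp hq
  have hu0 := ellipsoidRadial_nonneg (p := p) ht
  have hu1 := ellipsoidRadial_lt_one hp hq
  have hinner : ∀ b : ℕ, HasSum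
      (fun a : ℕ => ‖ellipsoidMonomial (b, a) q‖ ^ 2 / monomialNormSq p (b, a))
      (ballDefect q ^ (-(2 + 1 / p)) / Real.pi ^ 2 *
        (((b : ℝ) + 1) * ((b + 1) / p + 1) * ellipsoidRadial p q ^ b)) := by
    intro b
    have hx : ‖q 0‖ ^ 2 < 1 := sub_pos.1 ht
    -- The product in the norm of `z^a w^b` starts at `(b+1)/p + 1`. That factor is split off, and
    -- the rest is the rising factorial from `(b+1)/p + 2`.
    have h := (hasSum_binomial_one_sub (s := (b + 1) / p + 2) (sq_nonneg ‖q 0‖) hx).mul_left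
      (‖q 1‖ ^ (2 * b) * ((b + 1) / Real.pi ^ 2) * ((b + 1) / p + 1))
    have e1 : ellipsoidRadial p q ^ b = ‖q 1‖ ^ (2 * b) * ballDefect q ^ (-(b / p)) := by
      rw [ellipsoidRadial, mul_pow, ← pow_mul, ← Real.rpow_natCast (_ ^ _), ← Real.rpow_mul ht.le]
      congr 2
      ring
    have e2 : ballDefect q ^ (-((b + 1) / p + 2)) =
        ballDefect q ^ (-(2 + 1 / p)) * ballDefect q ^ (-(b / p)) := by
      rw [← Real.rpow_add ht]
      congr 1
      ring
    change HasSum _ (_ * ballDefect q ^ (-((b + 1) / p + 2))) at h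
    have e3 : ballDefect q ^ (-(2 + 1 / p)) / Real.pi ^ 2 *
        (((b : ℝ) + 1) * ((b + 1) / p + 1) * ellipsoidRadial p q ^ b) =
        ‖q 1‖ ^ (2 * b) * ((b + 1) / Real.pi ^ 2) * ((b + 1) / p + 1) *
          ballDefect q ^ (-((b + 1) / p + 2)) := by
      rw [e1, e2]; ring
    rw [e3]
    refine h.congr_fun fun a => ?_
    rw [monomialNormSq_eq hp, Finset.prod_range_succ', ellipsoidMonomial, norm_mul, norm_pow,
      norm_pow]
    have e4 : ∏ i ∈ Finset.range a, (((b : ℝ) + 1) / p + 1 + ((i + 1 : ℕ) : ℝ)) =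
        ∏ i ∈ Finset.range a, (((b : ℝ) + 1) / p + 2 + i) :=
      Finset.prod_congr rfl fun i _ => by push_cast; ring
    rw [e4]
    have hpos : 0 < ∏ i ∈ Finset.range a, (((b : ℝ) + 1) / p + 2 + i) :=
      Finset.prod_pos fun i _ => by positivity
    have hpi := Real.pi_ne_zero
    have hfac : (a.factorial : ℝ) ≠ 0 := by positivity
    push_cast
    generalize ∏ i ∈ Finset.range a, (((b : ℝ) + 1) / p + 2 + i) = P at hpos
    have := hpos.ne'
    have h3 : ((b : ℝ) + 1) / p + 1 ≠ 0 := by positivity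
    have h4 : (b : ℝ) + 1 ≠ 0 := by positivity
    rw [add_zero]
    generalize ((b : ℝ) + 1) / p + 1 = m at h3
    field_simp
    ring
  have houter := (hasSum_succ_mul hp (u := ellipsoidRadial p q)
    (by rwa [abs_of_nonneg hu0])).mul_left (ballDefect q ^ (-(2 + 1 / p)) / Real.pi ^ 2)
  have hnonneg : ∀ j : ℕ × ℕ, 0 ≤ ‖ellipsoidMonomial j q‖ ^ 2 / monomialNormSq p j := fun j =>
    div_nonneg (sq_nonneg _) (monomialNormSq_pos hp j).le
  -- The terms are nonnegative, so the iterated sums control the double series.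
  have hsum : Summable fun j : ℕ × ℕ => ‖ellipsoidMonomial j q‖ ^ 2 / monomialNormSq p j := by
    rw [summable_prod_of_nonneg hnonneg]
    refine ⟨fun b => (hinner b).summable, ?_⟩
    simp only [(hinner _).tsum_eq]
    exact houter.summable
  have h := hsum.hasSum.prod_fiberwise hinner
  have := h.unique houter
  rw [ellipsoidKernel]
  convert hsum.hasSum using 1
  rw [this]
  have hne : 1 - ellipsoidRadial p q ≠ 0 := by linarith
  have hpi := Real.pi_ne_zero
  field_simp

theorem hasSum_ellipsoidBasis_norm_sq (hp : 0 < p) {q : Fin 2 → ℂ} (hq : q ∈ ellipsoid p) :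
    HasSum (fun n => ‖ellipsoidBasis p n q‖ ^ 2) (ellipsoidKernel p q) := by
  refine ((Nat.pairEquiv.symm.hasSum_iff).2 (hasSum_ellipsoidKernel_pairs hp hq)).congr_fun
    fun n => ?_
  have hN := monomialNormSq_pos hp n.unpair
  rw [ellipsoidBasis, norm_mul, Complex.norm_real, mul_pow, norm_inv, Real.norm_of_nonneg
    (Real.sqrt_nonneg _), inv_pow, Real.sq_sqrt hN.le]
  simp only [Function.comp_apply, Nat.pairEquiv_symm_apply]
  ring

/-- Pointwise expansion of Bergman functions in the normalized monomials. -/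
theorem hasSum_ellipsoidBasis_mul_inner (hp : 0 < p) {f : (Fin 2 → ℂ) → ℂ}
    (hd : DifferentiableOn ℂ f (ellipsoid p)) (hf : MemLp f 2 (volume.restrict (ellipsoid p)))
    {q : Fin 2 → ℂ} (hq : q ∈ ellipsoid p) :
    HasSum (fun n => ellipsoidBasis p n q *
      ⟪(memLp_ellipsoidBasis hp n).toLp (ellipsoidBasis p n), hf.toLp f⟫_ℂ) (f q) := by
  obtain ⟨F, c, hF, hc⟩ := exists_hasSum_of_differentiableOn_ellipsoid hp hd
  -- The two normalizing factors cancel the squared norm in the coefficient integral, leaving the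
  -- power series term.
  have hterm : ∀ n, ellipsoidBasis p n q *
      ⟪(memLp_ellipsoidBasis hp n).toLp (ellipsoidBasis p n), hf.toLp f⟫_ℂ =
      c n.unpair.2 n.unpair.1 * q 0 ^ n.unpair.2 * q 1 ^ n.unpair.1 := by
    intro n
    have hN := monomialNormSq_pos hp n.unpair
    have hs : ((√(monomialNormSq p n.unpair))⁻¹ : ℝ) * ((√(monomialNormSq p n.unpair))⁻¹ : ℝ) *
        monomialNormSq p n.unpair = 1 := by
      rw [← mul_inv, Real.mul_self_sqrt hN.le, inv_mul_cancel₀ hN.ne']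
    have hs' : (((√(monomialNormSq p n.unpair))⁻¹ : ℝ) : ℂ) *
        ((√(monomialNormSq p n.unpair))⁻¹ : ℝ) * (monomialNormSq p n.unpair : ℝ) = 1 := by
      exact_mod_cast hs
    rw [inner_ellipsoidBasis hp, integral_conj_ellipsoidMonomial_mul hp hf hF hc, ellipsoidBasis,
      ellipsoidMonomial]
    linear_combination c n.unpair.2 n.unpair.1 * q 0 ^ n.unpair.2 * q 1 ^ n.unpair.1 * hs'
  have hsum : Summable fun n => ellipsoidBasis p n q *
      ⟪(memLp_ellipsoidBasis hp n).toLp (ellipsoidBasis p n), hf.toLp f⟫_ℂ := by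
    -- A product is at most the sum of the two squares; one family is summable by the kernel series,
    -- the other by Bessel's inequality.
    refine Summable.of_norm_bounded ((hasSum_ellipsoidBasis_norm_sq hp hq).summable.add
      ((orthonormal_ellipsoidBasis hp).inner_products_summable (x := hf.toLp f))) fun n => ?_
    rw [norm_mul]
    nlinarith [sq_nonneg (‖ellipsoidBasis p n q‖ -
      ‖⟪(memLp_ellipsoidBasis hp n).toLp (ellipsoidBasis p n), hf.toLp f⟫_ℂ‖),
      sq_nonneg ‖ellipsoidBasis p n q‖,
      sq_nonneg ‖⟪(memLp_ellipsoidBasis hp n).toLp (ellipsoidBasis p n), hf.toLp f⟫_ℂ‖]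
  obtain ⟨S, hS⟩ := hsum
  have hS' : HasSum (fun j : ℕ × ℕ => c j.2 j.1 * q 0 ^ j.2 * q 1 ^ j.1) S := by
    rw [← Nat.pairEquiv.symm.hasSum_iff]
    exact hS.congr_fun fun n => (hterm n).symm
  have hE := (mem_ellipsoid_iff hp).1 hq
  have hfib := hS'.prod_fiberwise fun b =>
    ((hc b (q 0) (by simpa using hE.1)).mul_right (q 1 ^ b))
  have hq' : (![q 0, q 1] : Fin 2 → ℂ) = q := by
    funext i; fin_cases i <;> rfl
  have hfinal := hF (q 0) (by simpa using hE.1) (q 1) (by simpa using hE.2)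
  rw [hq'] at hfinal
  rwa [hfib.unique hfinal] at hS

theorem isBergmanBasis_ellipsoidBasis (hp : 0 < p) :
    IsBergmanBasis (ellipsoid p) (ellipsoidBasis p) :=
  IsBergmanBasis.of_hasSum (isOpen_ellipsoid hp).measurableSet
    (fun n => ((differentiable_ellipsoidMonomial n.unpair).const_mul _).differentiableOn)
    (memLp_ellipsoidBasis hp) (orthonormal_ellipsoidBasis hp)
    fun _ hd hf _ hq => hasSum_ellipsoidBasis_mul_inner hp hd hf hq

/-- The definition picks an unspecified basis, so basis independence is needed to evaluate it with
the monomials. -/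
theorem bergmanKernel_ellipsoid (hp : 0 < p) {q : Fin 2 → ℂ} (hq : q ∈ ellipsoid p) :
    bergmanKernel (ellipsoid p) q = ellipsoidKernel p q := by
  have hex : ∃ φ : ℕ → (Fin 2 → ℂ) → ℂ, IsBergmanBasis (ellipsoid p) φ :=
    ⟨_, isBergmanBasis_ellipsoidBasis hp⟩
  rw [bergmanKernel, dif_pos hex]
  exact ((isBergmanBasis_ellipsoidBasis hp).hasSum_norm_sq hex.choose_spec
    (hasSum_ellipsoidBasis_norm_sq hp hq)
    fun _ hd hf => hasSum_ellipsoidBasis_mul_inner hp hd hf hq).tsum_eq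

/-- The expression is `p(1-u) + (1+u)`. -/
theorem kernelNumerator_pos (hp : 0 < p) {u : ℝ} (hu0 : 0 ≤ u) (hu1 : u < 1) :
    0 < (p + 1) + (1 - p) * u := by nlinarith

theorem ellipsoidKernel_pos (hp : 0 < p) {q : Fin 2 → ℂ} (hq : q ∈ ellipsoid p) :
    0 < ellipsoidKernel p q := by
  have ht := ballDefect_pos hp hq
  have hu1 := ellipsoidRadial_lt_one hp hq
  have hD := kernelNumerator_pos hp (ellipsoidRadial_nonneg (p := p) ht) hu1
  have h1 : 0 < 1 - ellipsoidRadial p q := sub_pos.2 hu1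
  have h2 := Real.rpow_pos_of_pos ht (-(2 + 1 / p))
  have h3 := Real.pi_pos
  rw [ellipsoidKernel]
  positivity

theorem contDiffOn_ellipsoidKernel (hp : 0 < p) :
    ContDiffOn ℝ ∞ (ellipsoidKernel p) (ellipsoid p) := by
  intro q hq
  refine ContDiffAt.contDiffWithinAt ?_
  have ht := ballDefect_pos hp hq
  have hu1 := ellipsoidRadial_lt_one hp hq
  have hcoord : ∀ i : Fin 2, ContDiffAt ℝ ∞ (fun q : Fin 2 → ℂ => ‖q i‖ ^ 2) q := fun i =>
    ((contDiff_norm_sq ℝ).comp (contDiff_apply ℝ ℂ i)).contDiffAt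
  have htd : ContDiffAt ℝ ∞ ballDefect q := contDiffAt_const.sub (hcoord 0)
  have hpow : ∀ s : ℝ, ContDiffAt ℝ ∞ (fun q => ballDefect q ^ s) q := fun s =>
    htd.rpow_const_of_ne ht.ne'
  have hu : ContDiffAt ℝ ∞ (ellipsoidRadial p) q := (hcoord 1).mul (hpow _)
  refine (hpow _).mul (ContDiffAt.div (contDiffAt_const.add (contDiffAt_const.mul hu))
    (contDiffAt_const.mul ((contDiffAt_const.sub hu).pow 3)) ?_)
  have h1 : 1 - ellipsoidRadial p q ≠ 0 := by linarith
  have := Real.pi_ne_zero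
  have := hp.ne'
  positivity

/-! ### The Bergman metric and its determinant. -/

/-- The radial part of the logarithm of the Bergman kernel. -/
noncomputable def kernelPotential (p u : ℝ) : ℝ :=
  Real.log ((p + 1) + (1 - p) * u) - 3 * Real.log (1 - u) - Real.log (p * Real.pi ^ 2)

/-- The first derivative of `kernelPotential`. -/
noncomputable def kernelPotential₁ (p u : ℝ) : ℝ :=
  (1 - p) / ((p + 1) + (1 - p) * u) + 3 / (1 - u)

/-- The second derivative of `kernelPotential`. -/
noncomputable def kernelPotential₂ (p u : ℝ) : ℝ :=
  -(1 - p) ^ 2 / ((p + 1) + (1 - p) * u) ^ 2 + 3 / (1 - u) ^ 2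

/-- The third derivative of `kernelPotential`. -/
noncomputable def kernelPotential₃ (p u : ℝ) : ℝ :=
  2 * (1 - p) ^ 3 / ((p + 1) + (1 - p) * u) ^ 3 + 6 / (1 - u) ^ 3

theorem hasDerivAt_kernelNumerator (p u : ℝ) :
    HasDerivAt (fun u => (p + 1) + (1 - p) * u) (1 - p) u := by
  simpa using ((hasDerivAt_id' u).const_mul (1 - p)).const_add (p + 1)

theorem hasDerivAt_one_sub (u : ℝ) : HasDerivAt (fun u : ℝ => 1 - u) (-1) u := by
  simpa using (hasDerivAt_id' u).const_sub 1

section Derivatives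

variable {u : ℝ}

theorem hasDerivAt_kernelPotential (hD : (p + 1) + (1 - p) * u ≠ 0) (hu : 1 - u ≠ 0) :
    HasDerivAt (kernelPotential p) (kernelPotential₁ p u) u := by
  have h := (((hasDerivAt_kernelNumerator p u).log hD).sub
    (((hasDerivAt_one_sub u).log hu).const_mul 3)).sub_const (Real.log (p * Real.pi ^ 2))
  refine h.congr_deriv ?_
  rw [kernelPotential₁]
  ring

theorem hasDerivAt_kernelPotential₁ (hD : (p + 1) + (1 - p) * u ≠ 0) (hu : 1 - u ≠ 0) :
    HasDerivAt (kernelPotential₁ p) (kernelPotential₂ p u) u := by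
  have h := ((hasDerivAt_const u (1 - p)).div (hasDerivAt_kernelNumerator p u) hD).add
    ((hasDerivAt_const u (3 : ℝ)).div (hasDerivAt_one_sub u) hu)
  refine h.congr_deriv ?_
  rw [kernelPotential₂]
  ring

theorem hasDerivAt_kernelPotential₂ (hD : (p + 1) + (1 - p) * u ≠ 0) (hu : 1 - u ≠ 0) :
    HasDerivAt (kernelPotential₂ p) (kernelPotential₃ p u) u := by
  have h := ((hasDerivAt_const u (-(1 - p) ^ 2)).div ((hasDerivAt_kernelNumerator p u).pow 2)
    (pow_ne_zero 2 hD)).add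
    ((hasDerivAt_const u (3 : ℝ)).div ((hasDerivAt_one_sub u).pow 2) (pow_ne_zero 2 hu))
  refine h.congr_deriv ?_
  rw [kernelPotential₃]
  simp only [Nat.cast_ofNat, Pi.pow_apply]
  field_simp
  ring

end Derivatives

theorem log_ellipsoidKernel (hp : 0 < p) {q : Fin 2 → ℂ} (hq : q ∈ ellipsoid p) :
    Real.log (ellipsoidKernel p q) = radialPotential p (2 + 1 / p) (kernelPotential p) q := by
  have ht := ballDefect_pos hp hq
  have hu1 := ellipsoidRadial_lt_one hp hq
  have hD := kernelNumerator_pos hp (ellipsoidRadial_nonneg (p := p) ht) hu1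
  have h1 : 0 < 1 - ellipsoidRadial p q := sub_pos.2 hu1
  have h2 := Real.rpow_pos_of_pos ht (-(2 + 1 / p))
  have h3 := Real.pi_pos
  rw [ellipsoidKernel, radialPotential, kernelPotential, Real.log_mul h2.ne' (by positivity),
    Real.log_rpow ht, Real.log_div hD.ne' (by positivity), Real.log_mul (by positivity)
    (by positivity), Real.log_pow]
  push_cast
  ring

/-- The first radial factor of the determinant of the Bergman metric. -/
noncomputable def metricFactorA (p u : ℝ) : ℝ := 2 + 1 / p + u * kernelPotential₁ p u / p

/-- The second radial factor of the determinant of the Bergman metric. -/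
noncomputable def metricFactorB (p u : ℝ) : ℝ := kernelPotential₁ p u + u * kernelPotential₂ p u

theorem bergmanMetric_ellipsoid (hp : 0 < p) {q : Fin 2 → ℂ} (hq : q ∈ ellipsoid p) :
    bergmanMetric (ellipsoid p) q =
      !![((metricFactorA p (ellipsoidRadial p q) + ‖q 0‖ ^ 2 * ellipsoidRadial p q *
          metricFactorB p (ellipsoidRadial p q) / p ^ 2) / ballDefect q ^ 2 : ℂ),
        (ballDefect q ^ (-(1 / p)) : ℝ) * q 1 * (starRingEnd ℂ) (q 0) / (p * ballDefect q) *
          metricFactorB p (ellipsoidRadial p q);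
        (ballDefect q ^ (-(1 / p)) : ℝ) * (starRingEnd ℂ) (q 1) * q 0 / (p * ballDefect q) *
          metricFactorB p (ellipsoidRadial p q),
        (ballDefect q ^ (-(1 / p)) : ℝ) * metricFactorB p (ellipsoidRadial p q)] := by
  have ht := ballDefect_pos hp hq
  have hu0 := ellipsoidRadial_nonneg (p := p) ht
  have hu1 := ellipsoidRadial_lt_one hp hq
  have hD := kernelNumerator_pos hp hu0 hu1
  have h1 : 0 < 1 - ellipsoidRadial p q := sub_pos.2 hu1
  have hlog : (fun x => ((Real.log (bergmanKernel (ellipsoid p) x) : ℝ) : ℂ)) =ᶠ[nhds q]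
      fun x => (radialPotential p (2 + 1 / p) (kernelPotential p) x : ℂ) := by
    filter_upwards [(isOpen_ellipsoid hp).mem_nhds hq] with x hx
    rw [bergmanKernel_ellipsoid hp hx, log_ellipsoidKernel hp hx]
  have hk : ∀ᶠ u in nhds (ellipsoidRadial p q),
      HasDerivAt (kernelPotential p) (kernelPotential₁ p u) u := by
    have e1 := (hasDerivAt_kernelNumerator p (ellipsoidRadial p q)).continuousAt.eventually_ne hD.ne'
    have e2 := (hasDerivAt_one_sub (ellipsoidRadial p q)).continuousAt.eventually_ne h1.ne'
    filter_upwards [e1, e2] with u h1 h2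
    exact hasDerivAt_kernelPotential h1 h2
  ext i j
  rw [bergmanMetric, Matrix.of_apply, hlog.dz_dzbar_eq, complexHessian_radialPotential p _ ht hk
    (hasDerivAt_kernelPotential₁ hD.ne' h1.ne')]
  simp only [metricFactorA, metricFactorB]
  push_cast
  rfl

/-- Since `|w|² t^(-1/p) = u`, the product of the off-diagonal entries cancels the `|z|² u B / p²`
term of the diagonal product. -/
theorem det_bergmanMetric_ellipsoid (hp : 0 < p) {q : Fin 2 → ℂ} (hq : q ∈ ellipsoid p) :
    (bergmanMetric (ellipsoid p) q).det.re =
      metricFactorA p (ellipsoidRadial p q) * metricFactorB p (ellipsoidRadial p q) *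
        ballDefect q ^ (-(1 / p)) / ballDefect q ^ 2 := by
  have ht := ballDefect_pos hp hq
  have hx : (‖q 0‖ ^ 2 : ℂ) = q 0 * (starRingEnd ℂ) (q 0) := by
    rw [Complex.mul_conj, Complex.normSq_eq_norm_sq]; push_cast; rfl
  have hy : (ellipsoidRadial p q : ℂ) =
      q 1 * (starRingEnd ℂ) (q 1) * ((ballDefect q ^ (-(1 / p)) : ℝ) : ℂ) := by
    rw [Complex.mul_conj, Complex.normSq_eq_norm_sq, ellipsoidRadial]; push_cast; rfl
  rw [bergmanMetric_ellipsoid hp hq, Matrix.det_fin_two_of, ← Complex.ofReal_re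
    (metricFactorA p (ellipsoidRadial p q) * metricFactorB p (ellipsoidRadial p q) *
      ballDefect q ^ (-(1 / p)) / ballDefect q ^ 2)]
  congr 1
  rw [hx]
  push_cast
  rw [hy]
  ring

/-! ### The Ricci tensor along `w = 0`. -/

/-- The radial part of the logarithm of the determinant of the Bergman metric. -/
noncomputable def detPotential (p u : ℝ) : ℝ :=
  Real.log (metricFactorA p u) + Real.log (metricFactorB p u)

/-- The derivative of `detPotential`. -/
noncomputable def detPotential₁ (p u : ℝ) : ℝ :=
  metricFactorB p u / p / metricFactorA p u +
    (2 * kernelPotential₂ p u + u * kernelPotential₃ p u) / metricFactorB p u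

theorem hasDerivAt_metricFactorA {u : ℝ} (hD : (p + 1) + (1 - p) * u ≠ 0) (hu : 1 - u ≠ 0) :
    HasDerivAt (metricFactorA p) (metricFactorB p u / p) u := by
  have h := (((hasDerivAt_id' u).mul (hasDerivAt_kernelPotential₁ hD hu)).div_const p).const_add
    (2 + 1 / p)
  refine h.congr_deriv ?_
  rw [metricFactorB]
  ring

theorem hasDerivAt_metricFactorB {u : ℝ} (hD : (p + 1) + (1 - p) * u ≠ 0) (hu : 1 - u ≠ 0) :
    HasDerivAt (metricFactorB p) (2 * kernelPotential₂ p u + u * kernelPotential₃ p u) u := by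
  have h := (hasDerivAt_kernelPotential₁ hD hu).add
    ((hasDerivAt_id' u).mul (hasDerivAt_kernelPotential₂ hD hu))
  refine h.congr_deriv ?_
  ring

theorem hasDerivAt_detPotential {u : ℝ} (hD : (p + 1) + (1 - p) * u ≠ 0) (hu : 1 - u ≠ 0)
    (hA : metricFactorA p u ≠ 0) (hB : metricFactorB p u ≠ 0) :
    HasDerivAt (detPotential p) (detPotential₁ p u) u :=
  ((hasDerivAt_metricFactorA hD hu).log hA).add ((hasDerivAt_metricFactorB hD hu).log hB)

theorem metricFactorA_zero (p : ℝ) : metricFactorA p 0 = 2 + 1 / p := by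
  simp [metricFactorA]

theorem metricFactorB_zero (hp : 0 < p) : metricFactorB p 0 = 2 * (p + 2) / (p + 1) := by
  simp only [metricFactorB, kernelPotential₁, mul_zero, zero_mul, add_zero, sub_zero]
  field_simp
  ring

/-- At `u = 0` the value is `B/(pA) + 2k''/B`, with `A = (2p+1)/p`, `B = 2(p+2)/(p+1)` and `k'' = 3
- (1-p)²/(1+p)²`. -/
theorem detPotential₁_zero (hp : 0 < p) : detPotential₁ p 0 =
    2 * (2 * p ^ 3 + 10 * p ^ 2 + 10 * p + 5) / ((p + 1) * (p + 2) * (2 * p + 1)) := by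
  rw [detPotential₁, metricFactorA_zero, metricFactorB_zero hp, kernelPotential₂]
  have h1 : 2 + 1 / p = (2 * p + 1) / p := by field_simp
  rw [h1]
  simp only [mul_zero, zero_mul, add_zero, sub_zero]
  field_simp
  ring

/-- Only existence matters: in the Hessian the second derivative is multiplied by `u`, which
vanishes here. -/
theorem differentiableAt_detPotential₁_zero (hp : 0 < p) :
    DifferentiableAt ℝ (detPotential₁ p) 0 := by
  have hD : (p + 1) + (1 - p) * (0 : ℝ) ≠ 0 := by simp; positivity
  have hu : (1 : ℝ) - 0 ≠ 0 := by norm_num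
  have hA := hasDerivAt_metricFactorA hD hu |>.differentiableAt
  have hB := hasDerivAt_metricFactorB hD hu |>.differentiableAt
  have h2 := hasDerivAt_kernelPotential₂ hD hu |>.differentiableAt
  have h3 : DifferentiableAt ℝ (kernelPotential₃ p) 0 := by
    have d1 := (hasDerivAt_kernelNumerator p 0).differentiableAt
    have d2 := (hasDerivAt_one_sub 0).differentiableAt
    exact ((differentiableAt_const _).div (d1.pow 3) (pow_ne_zero 3 hD)).add
      ((differentiableAt_const _).div (d2.pow 3) (pow_ne_zero 3 hu))
  have hA0 : metricFactorA p 0 ≠ 0 := by rw [metricFactorA_zero]; positivity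
  have hB0 : metricFactorB p 0 ≠ 0 := by rw [metricFactorB_zero hp]; positivity
  exact ((hB.div_const p).div hA hA0).add
    (((h2.const_mul 2).add (differentiableAt_id.mul h3)).div hB hB0)

/-- Because `t^(-1/p) / t² = t^(-(2+1/p))`, the function `log det g` is again a `radialPotential`,
and the Hessian formula applies once more. -/
theorem kaehlerRicci_ellipsoid (hp : 0 < p) {q : Fin 2 → ℂ} (hq : q ∈ ellipsoid p) (hq1 : q 1 = 0)
    (i j : Fin 2) : kaehlerRicci (bergmanMetric (ellipsoid p)) q i j =
      -!![((2 + 1 / p) / ballDefect q ^ 2 : ℂ), 0;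
        0, (ballDefect q ^ (-(1 / p)) : ℝ) * detPotential₁ p 0] i j := by
  have ht := ballDefect_pos hp hq
  have hu : ellipsoidRadial p q = 0 := by simp [ellipsoidRadial, hq1]
  have hD : (p + 1) + (1 - p) * (0 : ℝ) ≠ 0 := by simp; positivity
  have hone : (1 : ℝ) - 0 ≠ 0 := by norm_num
  have hA0 : 0 < metricFactorA p 0 := by rw [metricFactorA_zero]; positivity
  have hB0 : 0 < metricFactorB p 0 := by rw [metricFactorB_zero hp]; positivity
  have hAe := (hasDerivAt_metricFactorA hD hone).continuousAt.eventually (lt_mem_nhds hA0)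
  have hBe := (hasDerivAt_metricFactorB hD hone).continuousAt.eventually (lt_mem_nhds hB0)
  have hcu := continuousAt_ellipsoidRadial p ht
  rw [ContinuousAt, hu] at hcu
  have hlog : (fun x => ((Real.log (bergmanMetric (ellipsoid p) x).det.re : ℝ) : ℂ)) =ᶠ[nhds q]
      fun x => (radialPotential p (2 + 1 / p) (detPotential p) x : ℂ) := by
    -- Splitting the logarithm requires `A` and `B` to be positive; this is known at `u = 0` and
    -- extends to nearby points by continuity.
    filter_upwards [(isOpen_ellipsoid hp).mem_nhds hq, hcu.eventually hAe, hcu.eventually hBe]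
      with x hx hA hB
    have htx := ballDefect_pos hp hx
    have hs := Real.rpow_pos_of_pos htx (-(1 / p))
    rw [det_bergmanMetric_ellipsoid hp hx, radialPotential, detPotential,
      Real.log_div (by positivity) (by positivity), Real.log_mul (by positivity) hs.ne',
      Real.log_mul hA.ne' hB.ne', Real.log_rpow htx, Real.log_pow]
    congr 1
    push_cast
    ring
  have hk : ∀ᶠ u in nhds (ellipsoidRadial p q),
      HasDerivAt (detPotential p) (detPotential₁ p u) u := by
    rw [hu]
    filter_upwards [hAe, hBe, (hasDerivAt_kernelNumerator p 0).continuousAt.eventually_ne hD,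
      (hasDerivAt_one_sub 0).continuousAt.eventually_ne hone] with u hA hB h1 h2
    exact hasDerivAt_detPotential h1 h2 hA.ne' hB.ne'
  have hk' : HasDerivAt (detPotential₁ p) (deriv (detPotential₁ p) 0) (ellipsoidRadial p q) := by
    rw [hu]
    exact (differentiableAt_detPotential₁_zero hp).hasDerivAt
  rw [kaehlerRicci, Matrix.of_apply, hlog.dz_dzbar_eq,
    complexHessian_radialPotential p _ ht hk hk']
  fin_cases i <;> fin_cases j <;> simp [hu, hq1]

theorem posDef_bergmanMetric_ellipsoid (hp : 0 < p) {q : Fin 2 → ℂ} (hq : q ∈ ellipsoid p)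
    (hq1 : q 1 = 0) : (bergmanMetric (ellipsoid p) q).PosDef := by
  have ht := ballDefect_pos hp hq
  have hu : ellipsoidRadial p q = 0 := by simp [ellipsoidRadial, hq1]
  have hA0 : 0 < metricFactorA p 0 := by rw [metricFactorA_zero]; positivity
  have hB0 : 0 < metricFactorB p 0 := by rw [metricFactorB_zero hp]; positivity
  have hs := Real.rpow_pos_of_pos ht (-(1 / p))
  have e : bergmanMetric (ellipsoid p) q = Matrix.diagonal
      ![((metricFactorA p 0 / ballDefect q ^ 2 : ℝ) : ℂ),
        ((ballDefect q ^ (-(1 / p)) * metricFactorB p 0 : ℝ) : ℂ)] := by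
    rw [bergmanMetric_ellipsoid hp hq]
    ext i j
    fin_cases i <;> fin_cases j <;> simp [hu, hq1]
  rw [e, Matrix.posDef_diagonal_iff]
  intro i
  fin_cases i
  · exact Complex.zero_lt_real.2 (by positivity)
  · exact Complex.zero_lt_real.2 (by positivity)

end Ellipsoid

/-- The first two conjuncts and the positive definiteness say that the objects in the formulas are
genuine: the kernel is positive and smooth, and the metric is nondegenerate at the points in
question, so that all logarithms and derivatives near them are the usual ones. -/
theorem mainTheorem12 (p : ℝ) (hp : 0 < p) :
    (∀ q ∈ ellipsoid p, 0 < bergmanKernel (ellipsoid p) q) ∧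
    ContDiffOn ℝ ∞ (bergmanKernel (ellipsoid p)) (ellipsoid p) ∧
    ∀ q ∈ ellipsoid p, (starRingEnd ℂ) (q 0) = q 0 → q 1 = 0 →
      (bergmanMetric (ellipsoid p) q).PosDef ∧
      kaehlerRicci (bergmanMetric (ellipsoid p)) q 0 0 =
        ((-((2 * p + 1) / (p * (1 - ‖q 0‖ ^ 2) ^ 2)) : ℝ) : ℂ) ∧
      kaehlerRicci (bergmanMetric (ellipsoid p)) q 0 1 = 0 ∧
      kaehlerRicci (bergmanMetric (ellipsoid p)) q 1 0 = 0 ∧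
      kaehlerRicci (bergmanMetric (ellipsoid p)) q 1 1 =
        ((-(2 * (2 * p ^ 3 + 10 * p ^ 2 + 10 * p + 5) /
          ((p + 1) * (p + 2) * (2 * p + 1) * (1 - ‖q 0‖ ^ 2) ^ (1 / p))) : ℝ) : ℂ) := by
  refine ⟨fun q hq => ?_, ?_, fun q hq _ hq1 => ⟨posDef_bergmanMetric_ellipsoid hp hq hq1,
    ?_, ?_, ?_, ?_⟩⟩
  · rw [bergmanKernel_ellipsoid hp hq]
    exact ellipsoidKernel_pos hp hq
  · exact (contDiffOn_ellipsoidKernel hp).congr fun q hq => bergmanKernel_ellipsoid hp hq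
  all_goals rw [kaehlerRicci_ellipsoid hp hq hq1]
  · have ht := (ballDefect_pos hp hq).ne'
    have e : (2 * p + 1) / (p * (1 - ‖q 0‖ ^ 2) ^ 2) = (2 + 1 / p) / ballDefect q ^ 2 := by
      rw [ballDefect] at ht ⊢
      field_simp
    rw [e]
    push_cast
    rfl
  · simp
  · simp
  · have ht := ballDefect_pos hp hq
    have e : 2 * (2 * p ^ 3 + 10 * p ^ 2 + 10 * p + 5) /
        ((p + 1) * (p + 2) * (2 * p + 1) * (1 - ‖q 0‖ ^ 2) ^ (1 / p)) =
        ballDefect q ^ (-(1 / p)) * detPotential₁ p 0 := by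
      rw [detPotential₁_zero hp, Real.rpow_neg ht.le, ballDefect, inv_mul_eq_div, div_div]
    rw [e]
    push_cast
    rfl
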